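/- Let $\Sigma$ be a finite alphabet and $\mathcal X=\{x_1,x_2,\dots\}$ an infinite set of string variables. Consider quantifier-free formulas, i.e. Boolean combinations (with $\neg,\land,\lor,\Rightarrow,\Leftrightarrow$) of atoms of the following kinds: word equations $s_1=s_2$ with $s_1,s_2\in(\mathcal X\cup\Sigma)^*$; length constraints $\ell_1=\ell_2$, where $\ell_1,\ell_2$ are terms $k_0+k_1|s_1|+\dots+k_n|s_n|$ with $k_i\in\mathbb Z$ and $s_i\in\mathcal X\cup\Sigma^*$; and regular membership constraints $s\in L(M)$, where $s\in(\mathcal X\cup\Sigma)^*$ and $M$ is a nondeterministic finite automaton over $\Sigma$. The theory $\mathsf{WE+LEN}$ over $\Sigma$ consists of the formulas whose atoms are word equations and length constraints; the theory $\mathsf{WE+REG}$ over $\Sigma$ consists of the formulas whose atoms are word equations and regular membership constraints. Variables range over $\Sigma^*$. The language expressed by a variable $x$ occurring in a formula $f$ is the set of all $w\in\Sigma^*$ such that some substitution of words for the variables maps $x$ to $w$ and makes $f$ true; a language is expressible in a theory if it is expressed by some variable occurring in some formula of the theory. Subset-universality for a theory over $\Sigma$ is the problem: given a formula $f$ of the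 theory, a variable $x$ occurring in $f$, and $S\subsetneq\Sigma$ with $|S|>1$, is the language expressed by $x$ in $f$ equal to $S^*$? Theorem. (1) For every finite alphabet $\Sigma$, subset-universality is decidable for $\mathsf{WE+LEN}$ over $\Sigma$. Moreover, if $S\subsetneq\Sigma$ and $|S|>1$, then $S^*$ is not expressible in $\mathsf{WE+LEN}$ over $\Sigma$ (so the answer is always "no"). (2) There is $N\in\mathbb N$ such that subset-universality is undecidable for $\mathsf{WE+REG}$ over every finite alphabet $\Sigma$ with $|\Sigma|>N$; and, for every finite alphabet $\Sigma$ and every fixed $S\subseteq\Sigma$ with $|S|\ge N$, it is undecidable, given a formula $f$ of $\mathsf{WE+REG}$ over $\Sigma$ and a variable $x$ occurring in $f$, whether the language expressed by $x$ in $f$ is exactly $S^*$. -/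

import Mathlib

/-!
Quantifier-free theories of word equations, linear length constraints and regular membership
constraints over a finite alphabet `A`, the languages expressed by their formulas, and decision
problems for these languages. String variables are indexed by `ℕ`.
-/

universe u

namespace StringTheory

/-! ### Syntax -/

/-- An extended string term: a word over letters (`Sum.inl a`) and variables (`Sum.inr x`). -/
abbrev Term (A : Type u) : Type u := List (A ⊕ ℕ)

/-- A basic string term: a constant word or a single variable. -/
abbrev BasicTerm (A : Type u) : Type u := List A ⊕ ℕ

/-- The length term `k₀ + k₁ |s₁| + ... + kₙ |sₙ|`, given as `(k₀, [(k₁, s₁), ..., (kₙ, sₙ)])`. -/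
abbrev LengthTerm (A : Type u) : Type u := ℤ × List (ℤ × BasicTerm A)

/-- A nondeterministic finite automaton as a finite object: the lists of its initial states, of
its accepting states, and of its transitions `(p, a, q)` (from `p` to `q` when reading `a`).
States are named by natural numbers, and only finitely many of them are mentioned. -/
abbrev Automaton (A : Type u) : Type u := List ℕ × List ℕ × List (ℕ × A × ℕ)

/-- Atoms: membership `s ∈ L(M)`, length constraints `ℓ₁ = ℓ₂`, word equations `s₁ = s₂`. -/
inductive Atom (A : Type u) : Type u
  | mem (s : Term A) (M : Automaton A)
  | len (l₁ l₂ : LengthTerm A)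
  | eq (s₁ s₂ : Term A)

/-- Formulas: Boolean combinations of atoms. -/
inductive Formula (A : Type u) : Type u
  | atom (p : Atom A)
  | neg (f : Formula A)
  | and (f g : Formula A)
  | or (f g : Formula A)
  | imp (f g : Formula A)
  | iff (f g : Formula A)

variable {A : Type u}

/-- The variables occurring in a basic string term. -/
def BasicTerm.vars : BasicTerm A → Set ℕ
  | Sum.inl _ => ∅
  | Sum.inr x => {x}

/-- The variables occurring in an extended string term. -/
def Term.vars (s : Term A) : Set ℕ := {x | Sum.inr x ∈ s}

/-- The variables occurring in a length term. -/
def LengthTerm.vars (l : LengthTerm A) : Set ℕ := {x | ∃ t ∈ l.2, x ∈ BasicTerm.vars t.2}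

/-- The variables occurring in an atom. -/
def Atom.vars : Atom A → Set ℕ
  | .mem s _ => Term.vars s
  | .len l₁ l₂ => LengthTerm.vars l₁ ∪ LengthTerm.vars l₂
  | .eq s₁ s₂ => Term.vars s₁ ∪ Term.vars s₂

/-- The variables occurring in a formula. -/
def Formula.vars : Formula A → Set ℕ
  | .atom p => p.vars
  | .neg f => f.vars
  | .and f g => f.vars ∪ g.vars
  | .or f g => f.vars ∪ g.vars
  | .imp f g => f.vars ∪ g.vars
  | .iff f g => f.vars ∪ g.vars

/-- All atoms occurring in the formula satisfy `P`. -/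
def Formula.AllAtoms (P : Atom A → Prop) : Formula A → Prop
  | .atom p => P p
  | .neg f => f.AllAtoms P
  | .and f g => f.AllAtoms P ∧ g.AllAtoms P
  | .or f g => f.AllAtoms P ∧ g.AllAtoms P
  | .imp f g => f.AllAtoms P ∧ g.AllAtoms P
  | .iff f g => f.AllAtoms P ∧ g.AllAtoms P

/-- The atom is a word equation. -/
def Atom.IsEq : Atom A → Prop
  | .eq _ _ => True
  | _ => False

/-- The atom is a length constraint. -/
def Atom.IsLen : Atom A → Prop
  | .len _ _ => True
  | _ => False

/-- The atom is a regular membership constraint. -/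
def Atom.IsMem : Atom A → Prop
  | .mem _ _ => True
  | _ => False

/-- The theory WE+LEN over `A`: its atoms are word equations and length constraints. -/
def WELEN (A : Type u) : Set (Formula A) := {f | f.AllAtoms fun p => p.IsEq ∨ p.IsLen}

/-- The theory WE+REG over `A`: its atoms are word equations and regular membership
constraints. -/
def WEREG (A : Type u) : Set (Formula A) := {f | f.AllAtoms fun p => p.IsEq ∨ p.IsMem}

/-! ### Semantics -/

/-- A substitution maps every variable to a word. -/
abbrev Subst (A : Type u) : Type u := ℕ → List A

/-- Value of an extended string term: the morphism that extends the substitution and fixes all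
letters. -/
def Term.eval (h : Subst A) (s : Term A) : List A := s.flatMap (Sum.elim (fun a => [a]) h)

/-- Value of a basic string term. -/
def BasicTerm.eval (h : Subst A) : BasicTerm A → List A
  | Sum.inl w => w
  | Sum.inr x => h x

/-- Value of a length term. -/
def LengthTerm.eval (h : Subst A) (l : LengthTerm A) : ℤ :=
  l.1 + (l.2.map fun t => t.1 * ((BasicTerm.eval h t.2).length : ℤ)).sum

/-- The automaton as one of Mathlib's `NFA`s. -/
def Automaton.toNFA (M : Automaton A) : NFA A ℕ where
  start := {q | q ∈ M.1}
  accept := {q | q ∈ M.2.1}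
  step p a := {q | (p, a, q) ∈ M.2.2}

/-- Truth of an atom under a substitution. -/
def Atom.Holds (h : Subst A) : Atom A → Prop
  | .mem s M => Term.eval h s ∈ (Automaton.toNFA M).accepts
  | .len l₁ l₂ => LengthTerm.eval h l₁ = LengthTerm.eval h l₂
  | .eq s₁ s₂ => Term.eval h s₁ = Term.eval h s₂

/-- Truth of a formula under a substitution. -/
def Formula.Holds (h : Subst A) : Formula A → Prop
  | .atom p => p.Holds h
  | .neg f => ¬ f.Holds h
  | .and f g => f.Holds h ∧ g.Holds h
  | .or f g => f.Holds h ∨ g.Holds h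
  | .imp f g => f.Holds h → g.Holds h
  | .iff f g => (f.Holds h ↔ g.Holds h)

/-- The language expressed by the variable `x` in the formula `f`. -/
def Formula.lang (f : Formula A) (x : ℕ) : Language A :=
  {w | ∃ h : Subst A, h x = w ∧ f.Holds h}

/-- `L` is expressible in the theory `T`. -/
def Expressible (T : Set (Formula A)) (L : Language A) : Prop :=
  ∃ f ∈ T, ∃ x ∈ f.vars, f.lang x = L

/-- The language `S*` of all words whose letters belong to `S`. -/
def starOf (S : Set A) : Language A := {w | ∀ a ∈ w, a ∈ S}

/-! ### Formulas as inputs of algorithms -/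

/-- Atoms are a sum of products of lists. -/
def Atom.equivSum : Atom A ≃
    (Term A × Automaton A) ⊕ ((LengthTerm A × LengthTerm A) ⊕ (Term A × Term A)) where
  toFun
    | .mem s M => Sum.inl (s, M)
    | .len l₁ l₂ => Sum.inr (Sum.inl (l₁, l₂))
    | .eq s₁ s₂ => Sum.inr (Sum.inr (s₁, s₂))
  invFun
    | Sum.inl (s, M) => .mem s M
    | Sum.inr (Sum.inl (l₁, l₂)) => .len l₁ l₂
    | Sum.inr (Sum.inr (s₁, s₂)) => .eq s₁ s₂
  left_inv p := by cases p <;> rfl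
  right_inv p := by rcases p with ⟨_, _⟩ | ⟨_, _⟩ | ⟨_, _⟩ <;> rfl

instance Atom.primcodable [Primcodable A] : Primcodable (Atom A) :=
  Primcodable.ofEquiv _ Atom.equivSum

/-- The standard coding of formulas by natural numbers. -/
def Formula.enc [Primcodable A] : Formula A → ℕ
  | .atom p => 6 * Encodable.encode p
  | .neg f => 6 * f.enc + 1
  | .and f g => 6 * Nat.pair f.enc g.enc + 2
  | .or f g => 6 * Nat.pair f.enc g.enc + 3
  | .imp f g => 6 * Nat.pair f.enc g.enc + 4
  | .iff f g => 6 * Nat.pair f.enc g.enc + 5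

/-- The binary connective with code `r`. -/
def Formula.binary (r : ℕ) (f g : Formula A) : Formula A :=
  if r = 2 then .and f g else if r = 3 then .or f g else if r = 4 then .imp f g else .iff f g

/-- The decoding function that belongs to `Formula.enc`. -/
def Formula.dec [Primcodable A] (n : ℕ) : Option (Formula A) :=
  if h0 : n % 6 = 0 then (Encodable.decode (n / 6) : Option (Atom A)).map .atom
  else
    have h : n / 6 < n := by omega
    have _h1 : (n / 6).unpair.1 < n := lt_of_le_of_lt (Nat.unpair_left_le _) h
    have _h2 : (n / 6).unpair.2 < n := lt_of_le_of_lt (Nat.unpair_right_le _) h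
    if n % 6 = 1 then (Formula.dec (n / 6)).map .neg
    else (Formula.dec (n / 6).unpair.1).bind fun f =>
      (Formula.dec (n / 6).unpair.2).map fun g => .binary (n % 6) f g
termination_by n

theorem Formula.dec_enc [Primcodable A] (f : Formula A) : Formula.dec f.enc = some f := by
  have e (m r : ℕ) (hr : r < 6) : (6 * m + r) / 6 = m ∧ (6 * m + r) % 6 = r := by omega
  induction f with
  | atom p => rw [dec]; simp [enc]
  | neg f ih =>
    rw [dec]; simp [enc, e _ 1 (by omega), ih]
  | and f g ihf ihg =>
    rw [dec]; simp [enc, e _ 2 (by omega), ihf, ihg, binary]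
  | or f g ihf ihg =>
    rw [dec]; simp [enc, e _ 3 (by omega), ihf, ihg, binary]
  | imp f g ihf ihg =>
    rw [dec]; simp [enc, e _ 4 (by omega), ihf, ihg, binary]
  | iff f g ihf ihg =>
    rw [dec]; simp [enc, e _ 5 (by omega), ihf, ihg, binary]

theorem Formula.enc_binary [Primcodable A] {r : ℕ} (h0 : r ≠ 0) (h1 : r ≠ 1) (h6 : r < 6)
    (f g : Formula A) : (Formula.binary r f g).enc = 6 * Nat.pair f.enc g.enc + r := by
  unfold binary
  split_ifs with h2 h3 h4
  · simp [enc, h2]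
  · simp [enc, h3]
  · simp [enc, h4]
  · have : r = 5 := by omega
    simp [enc, this]

/-- One step of the computation of `fun n => (Formula.dec n).map Formula.enc` from the list of
its earlier values. -/
def Formula.recode (A : Type u) [Primcodable A] (l : List (Option ℕ)) : Option ℕ :=
  if l.length % 6 = 0 then
    (Encodable.decode (l.length / 6) : Option (Atom A)).map fun p => 6 * Encodable.encode p
  else if l.length % 6 = 1 then
    (l[l.length / 6]?.getD none).map fun a => 6 * a + 1
  else (l[(l.length / 6).unpair.1]?.getD none).bind fun a =>
    (l[(l.length / 6).unpair.2]?.getD none).map fun b => 6 * Nat.pair a b + l.length % 6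

theorem Formula.recode_primrec (A : Type u) [Primcodable A] : Primrec (Formula.recode A) := by
  have hlen : Primrec fun l : List (Option ℕ) => l.length := Primrec.list_length
  have hd : Primrec fun l : List (Option ℕ) => l.length / 6 :=
    Primrec.nat_div.comp hlen (Primrec.const 6)
  have hm : Primrec fun l : List (Option ℕ) => l.length % 6 :=
    Primrec.nat_mod.comp hlen (Primrec.const 6)
  have hget {k : List (Option ℕ) → ℕ} (hk : Primrec k) :
      Primrec fun l : List (Option ℕ) => l[k l]?.getD none :=
    Primrec.option_getD.comp (Primrec.list_getElem?.comp Primrec.id hk) (Primrec.const none)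
  have h6 {α : Type u} [Primcodable α] {k : α → ℕ} (hk : Primrec k) :
      Primrec fun a => 6 * k a := Primrec.nat_mul.comp (Primrec.const 6) hk
  have h6' {α : Type} [Primcodable α] {k : α → ℕ} (hk : Primrec k) :
      Primrec fun a => 6 * k a := Primrec.nat_mul.comp (Primrec.const 6) hk
  refine Primrec.ite (Primrec.eq.comp hm (Primrec.const 0)) ?_
    (Primrec.ite (Primrec.eq.comp hm (Primrec.const 1)) ?_ ?_)
  · exact Primrec.option_map (Primrec.decode.comp hd)
      (h6 (Primrec.encode.comp Primrec.snd)).to₂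
  · exact Primrec.option_map (hget hd)
      (Primrec.nat_add.comp (h6' Primrec.snd) (Primrec.const 1)).to₂
  · have hu := Primrec.unpair.comp hd
    refine Primrec.option_bind (hget (Primrec.fst.comp hu)) ?_
    refine Primrec.option_map ((hget (Primrec.snd.comp hu)).comp Primrec.fst) ?_
    exact (Primrec.nat_add.comp
      (h6' (Primrec₂.natPair.comp (Primrec.snd.comp Primrec.fst) Primrec.snd))
      (hm.comp (Primrec.fst.comp Primrec.fst))).to₂

theorem Formula.recode_spec [Primcodable A] (n : ℕ) :
    Formula.recode A ((List.range n).map fun k => (Formula.dec (A := A) k).map Formula.enc) =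
      (Formula.dec (A := A) n).map Formula.enc := by
  unfold recode
  rw [dec]
  simp only [List.length_map, List.length_range]
  split_ifs with h0 h1
  · simp [Option.map_map, Function.comp_def, enc]
  · have h : n / 6 < n := by omega
    simp [h, Option.map_map, Function.comp_def, enc]
  · have h : n / 6 < n := by omega
    have hl := lt_of_le_of_lt (Nat.unpair_left_le (n / 6)) h
    have hr := lt_of_le_of_lt (Nat.unpair_right_le (n / 6)) h
    simp only [List.getElem?_map, List.getElem?_range hl, List.getElem?_range hr,
      Option.map_some, Option.getD_some]
    cases dec (A := A) (n / 6).unpair.1 <;> cases dec (A := A) (n / 6).unpair.2 <;>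
      simp [enc_binary h0 h1 (Nat.mod_lt n (by omega))]

instance Formula.primcodable [Primcodable A] : Primcodable (Formula A) where
  encode := Formula.enc
  decode := Formula.dec
  encodek := Formula.dec_enc
  prim := by
    have h : Primrec fun n : ℕ => (Formula.dec (A := A) n).map Formula.enc :=
      (Primrec.nat_strong_rec (fun (_ : Unit) n => (Formula.dec (A := A) n).map Formula.enc)
        (g := fun _ l => some (Formula.recode A l))
        (Primrec.option_some.comp ((Formula.recode_primrec A).comp Primrec.snd)).to₂
        (fun _ n => by rw [Formula.recode_spec])).comp (Primrec.const ()) Primrec.id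
    refine (Primrec.nat_iff.1 (Primrec.encode.comp h)).of_eq fun n => ?_
    cases h : Formula.dec (A := A) n <;> simp [Encodable.encode]

/-! ### Decision problems -/

/-- A decision problem whose instances are the inputs `a : α` with `Valid a` and whose question is
`Yes a` is decidable if some algorithm answers it correctly on all instances. -/
def DecidableProblem {α : Type u} [Primcodable α] (Valid Yes : α → Prop) : Prop :=
  ∃ d : α → Bool, Computable d ∧ ∀ a, Valid a → (d a = true ↔ Yes a)

/-- For a fixed set `S` of letters: given a formula `f` of the theory `T` and a variable `x`
occurring in `f`, it is decidable whether `x` expresses `S*` in `f`. -/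
def StarProblemDecidable [Primcodable A] (T : Set (Formula A)) (S : Set A) : Prop :=
  DecidableProblem (α := Formula A × ℕ) (fun i => i.1 ∈ T ∧ i.2 ∈ i.1.vars)
    (fun i => i.1.lang i.2 = starOf S)

/-- Subset-universality for the theory `T`: given a formula `f` of `T`, a variable `x` occurring
in `f`, and a proper subset `S` of the alphabet (by a list of its letters) with more than one
element, it is decidable whether `x` expresses `S*` in `f`. -/
def SubsetUniversalityDecidable [Primcodable A] (T : Set (Formula A)) : Prop :=
  DecidableProblem (α := (Formula A × ℕ) × List A)
    (fun i => i.1.1 ∈ T ∧ i.1.2 ∈ i.1.1.vars ∧ 1 < {a | a ∈ i.2}.ncard ∧ {a | a ∈ i.2} ⊂ Set.univ)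
    (fun i => i.1.1.lang i.1.2 = starOf {a | a ∈ i.2})

end StringTheory

/-! For WE+LEN, take `a ≠ b` in `S` and `c` outside `S`. For each `k`, `swapWord a b c k` exchanges
the maximal `a`-free factors `bᵏb` and `bᵏc` of a word. It is an injective, length-preserving map,
and for given words it commutes with a concatenation for all but at most three `k`, because only the
block across the seam can go wrong. So applying it to all values of a substitution preserves the
truth of a formula, except for a number of `k` bounded in terms of the formula alone
(`Formula.exists_holds_swapWord`). If `x` expressed `S*`, a word over `S` with blocks `bᵏb` for more
values of `k` than this bound would be mapped to a word of the same language that contains `c`.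

For WE+REG, halting is reduced to the problem. A fixed code with undecidable halting problem is run
by a stack machine whose computations are written as words over four letters of `S`. The formula
confines variable 0 to `S*` and says that it is not a halting computation on input `n`. Being wrong
is an existential property: the word is no code, or it starts or ends wrongly, or some configuration
is followed by a wrong one. The other variables supply the witness. A step rewrites a bounded part
of the configuration, so finitely many word equations, disequations and regular constraints describe
all errors. Variable 0 expresses `S*` exactly if no halting computation exists
(`forall_exists_iff_forall_not_trace`, `exists_trace_iff`). -/

namespace StringTheory

variable {A : Type u}

/-! ### Block swaps and inexpressibility in WE+LEN -/

section Swap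

open Classical in
/-- Exchanges the words `bᵏb` and `bᵏc` and fixes all other words. -/
noncomputable def swapBlock (b c : A) (k : ℕ) (m : List A) : List A :=
  if m = List.replicate k b ++ [b] then List.replicate k b ++ [c]
  else if m = List.replicate k b ++ [c] then List.replicate k b ++ [b] else m

theorem length_swapBlock (b c : A) (k : ℕ) (m : List A) :
    (swapBlock b c k m).length = m.length := by
  unfold swapBlock
  split_ifs with h1 h2 <;> simp [*]

theorem swapBlock_swapBlock (b c : A) (k : ℕ) (m : List A) :
    swapBlock b c k (swapBlock b c k m) = m := by
  by_cases h1 : m = List.replicate k b ++ [b]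
  · by_cases h : c = b <;> simp [swapBlock, h1, h]
  · by_cases h2 : m = List.replicate k b ++ [c]
    · by_cases h : c = b <;> simp [swapBlock, h2, h]
    · simp [swapBlock, h1, h2]

theorem swapBlock_of_length_ne {b c : A} {k : ℕ} {m : List A} (h : m.length ≠ k + 1) :
    swapBlock b c k m = m := by
  rw [swapBlock, if_neg, if_neg] <;> rintro rfl <;> simp at h

theorem notMem_swapBlock {a b c : A} (hb : a ≠ b) (hc : a ≠ c) (k : ℕ) {m : List A}
    (h : a ∉ m) : a ∉ swapBlock b c k m := by
  unfold swapBlock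
  split_ifs <;> simp_all

open Classical in
/-- Applies `swapBlock b c k` to all segments between occurrences of `a`; the letters in `acc` are
put in front of the first segment. -/
noncomputable def swapFrom (a b c : A) (k : ℕ) : List A → List A → List A
  | acc, [] => swapBlock b c k acc
  | acc, x :: w => if x = a then swapBlock b c k acc ++ a :: swapFrom a b c k [] w
    else swapFrom a b c k (acc ++ [x]) w

theorem length_swapFrom (a b c : A) (k : ℕ) (acc w : List A) :
    (swapFrom a b c k acc w).length = acc.length + w.length := by
  induction w generalizing acc with
  | nil => simp [swapFrom, length_swapBlock]
  | cons x w ih =>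
    rw [swapFrom]
    split_ifs
    · simp [ih, length_swapBlock]
    · simp [ih]; omega

theorem swapFrom_of_notMem {a b c : A} {k : ℕ} (acc : List A) {m : List A} (hm : a ∉ m) :
    swapFrom a b c k acc m = swapBlock b c k (acc ++ m) := by
  induction m generalizing acc with
  | nil => simp [swapFrom]
  | cons x m ih =>
    simp only [List.mem_cons, not_or] at hm
    rw [swapFrom, if_neg (Ne.symm hm.1), ih _ hm.2]
    simp

theorem swapFrom_append_cons {a b c : A} {k : ℕ} (acc : List A) {m : List A} (hm : a ∉ m)
    (w : List A) : swapFrom a b c k acc (m ++ a :: w) =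
      swapBlock b c k (acc ++ m) ++ a :: swapFrom a b c k [] w := by
  induction m generalizing acc with
  | nil => simp [swapFrom]
  | cons x m ih =>
    simp only [List.mem_cons, not_or] at hm
    rw [List.cons_append, swapFrom, if_neg (Ne.symm hm.1), ih _ hm.2]
    simp

/-- Swapping a block neither creates nor destroys an `a`, so the second pass sees the same
segmentation and undoes the swap block by block. -/
theorem swapFrom_swapFrom {a b c : A} (hb : a ≠ b) (hc : a ≠ c) (k : ℕ) {acc : List A}
    (hacc : a ∉ acc) (w : List A) :
    swapFrom a b c k [] (swapFrom a b c k acc w) = acc ++ w := by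
  induction w generalizing acc with
  | nil =>
    rw [swapFrom, swapFrom_of_notMem _ (notMem_swapBlock hb hc k hacc)]
    simp [swapBlock_swapBlock]
  | cons x w ih =>
    rw [swapFrom]
    split_ifs with h
    · rw [swapFrom_append_cons _ (notMem_swapBlock hb hc k hacc), ih (by simp)]
      simp [swapBlock_swapBlock, h]
    · rw [ih (by simp [hacc, Ne.symm h])]
      simp

/-- Here `p` is the length of the first block of `v`. The two sides differ only in whether `acc` and
that block are swapped together or apart, and a word is moved only if its length is `k + 1`.
Excluding three lengths makes all these swaps trivial. -/
theorem exists_swapFrom_eq (a b c : A) (acc v : List A) :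
    ∃ p : ℕ, ∀ k, k ∉ ({acc.length - 1, p - 1, acc.length + p - 1} : Finset ℕ) →
      swapFrom a b c k acc v = swapBlock b c k acc ++ swapFrom a b c k [] v := by
  have key : ∀ (m : List A) (k : ℕ),
      k ∉ ({acc.length - 1, m.length - 1, acc.length + m.length - 1} : Finset ℕ) →
      swapBlock b c k (acc ++ m) = swapBlock b c k acc ++ swapBlock b c k m := by
    intro m k hk
    simp only [Finset.mem_insert, Finset.mem_singleton, not_or] at hk
    rw [swapBlock_of_length_ne, swapBlock_of_length_ne, swapBlock_of_length_ne]
    · omega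
    · omega
    · rw [List.length_append]; omega
  by_cases ha : a ∈ v
  · obtain ⟨m, w, rfl, hm⟩ := List.eq_append_cons_of_mem ha
    refine ⟨m.length, fun k hk => ?_⟩
    rw [swapFrom_append_cons _ hm, swapFrom_append_cons _ hm, key m k hk]
    simp
  · refine ⟨v.length, fun k hk => ?_⟩
    rw [swapFrom_of_notMem _ ha, swapFrom_of_notMem _ ha, key v k hk]
    simp

theorem exists_swapFrom_append (a b c : A) (acc u v : List A) :
    ∃ B : Finset ℕ, B.card ≤ 3 ∧ ∀ k, k ∉ B →
      swapFrom a b c k acc (u ++ v) = swapFrom a b c k acc u ++ swapFrom a b c k [] v := by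
  induction u generalizing acc with
  | nil =>
    obtain ⟨p, hp⟩ := exists_swapFrom_eq a b c acc v
    exact ⟨_, Finset.card_le_three, fun k hk => by simpa [swapFrom] using hp k hk⟩
  | cons x u ih =>
    by_cases h : x = a
    · obtain ⟨B, hB, hk⟩ := ih []
      exact ⟨B, hB, fun k hkB => by simp [swapFrom, h, hk k hkB]⟩
    · obtain ⟨B, hB, hk⟩ := ih (acc ++ [x])
      exact ⟨B, hB, fun k hkB => by simp [swapFrom, h, hk k hkB]⟩

theorem swapFrom_flatMap {a b : A} (hb : a ≠ b) (c : A) (k : ℕ) (l : List ℕ) :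
    swapFrom a b c k [] (l.flatMap fun i => List.replicate (i + 1) b ++ [a]) =
      (l.flatMap fun i => swapBlock b c k (List.replicate (i + 1) b) ++ [a]) ++
        swapBlock b c k [] := by
  induction l with
  | nil => simp [swapFrom]
  | cons i l ih =>
    simp only [List.flatMap_cons, List.append_assoc, List.singleton_append]
    rw [swapFrom_append_cons _ (by simp [hb]), ih]
    simp

/-- The involution of words that exchanges the maximal `a`-free factors `bᵏb` and `bᵏc`. -/
noncomputable def swapWord (a b c : A) (k : ℕ) (w : List A) : List A := swapFrom a b c k [] w

theorem swapWord_injective {a b c : A} (hb : a ≠ b) (hc : a ≠ c) (k : ℕ) :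
    Function.Injective (swapWord a b c k) :=
  Function.LeftInverse.injective (g := swapWord a b c k) fun w =>
    swapFrom_swapFrom hb hc k (List.not_mem_nil (a := a)) w

theorem swapWord_nil (a b c : A) (k : ℕ) : swapWord a b c k [] = [] := by
  rw [swapWord, swapFrom, swapBlock_of_length_ne (by simp)]

theorem swapWord_singleton (a b c : A) {k : ℕ} (hk : k ≠ 0) (x : A) :
    swapWord a b c k [x] = [x] := by
  by_cases h : x = a
  · simp [swapWord, swapFrom, h, swapBlock_of_length_ne]
  · rw [swapWord, swapFrom, if_neg h, swapFrom, swapBlock_of_length_ne (by simp; omega)]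
    simp

theorem Term.exists_swapWord_eval (a b c : A) (s : Term A) (h : Subst A) :
    ∃ B : Finset ℕ, B.card ≤ 4 * s.length ∧ ∀ k, k ∉ B →
      Term.eval (fun x => swapWord a b c k (h x)) s = swapWord a b c k (Term.eval h s) := by
  classical
  induction s with
  | nil => exact ⟨∅, by simp, fun k _ => by simp [Term.eval, swapWord_nil]⟩
  | cons t s ih =>
    obtain ⟨B, hB, hk⟩ := ih
    obtain ⟨B', hB', hk'⟩ := exists_swapFrom_append a b c []
      (Sum.elim (fun a => [a]) h t) (Term.eval h s)
    -- Each symbol costs three values of `k` for the concatenation, and the value 0, for which the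
    -- one-letter blocks `b` and `c` would be exchanged and constants would not be fixed.
    refine ⟨B ∪ B' ∪ {0}, ?_, fun k hkB => ?_⟩
    · have h1 := Finset.card_union_le (B ∪ B') {0}
      have h2 := Finset.card_union_le B B'
      simp only [Finset.card_singleton, List.length_cons] at *
      omega
    · simp only [Finset.mem_union, Finset.mem_singleton, not_or] at hkB
      have e1 := hk k hkB.1.1
      have e2 := hk' k hkB.1.2
      simp only [Term.eval, List.flatMap_cons] at *
      rw [e1, swapWord, swapWord, e2]
      congr 1
      rcases t with x | x
      · exact (swapWord_singleton a b c hkB.2 x).symm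
      · rfl

theorem LengthTerm.eval_swapWord (a b c : A) (k : ℕ) (l : LengthTerm A) (h : Subst A) :
    LengthTerm.eval (fun x => swapWord a b c k (h x)) l = LengthTerm.eval h l := by
  unfold LengthTerm.eval
  congr 2
  refine List.map_congr_left fun t _ => ?_
  rcases t with ⟨m, w | x⟩
  · rfl
  · simp [BasicTerm.eval, swapWord, length_swapFrom]

/-- The exceptional set may depend on `h`, but its size is bounded by `C` uniformly. Equations keep
their truth value in both directions because the swap is injective, so negation does no harm. -/
theorem Formula.exists_holds_swapWord {a b c : A} (hb : a ≠ b) (hc : a ≠ c) (f : Formula A)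
    (hf : f ∈ WELEN A) : ∃ C : ℕ, ∀ h : Subst A, ∃ B : Finset ℕ, B.card ≤ C ∧ ∀ k, k ∉ B →
      (f.Holds (fun x => swapWord a b c k (h x)) ↔ f.Holds h) := by
  classical
  have binary : ∀ (f g : Formula A)
      (_ : ∃ C : ℕ, ∀ h : Subst A, ∃ B : Finset ℕ, B.card ≤ C ∧ ∀ k, k ∉ B →
        (f.Holds (fun x => swapWord a b c k (h x)) ↔ f.Holds h))
      (_ : ∃ C : ℕ, ∀ h : Subst A, ∃ B : Finset ℕ, B.card ≤ C ∧ ∀ k, k ∉ B →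
        (g.Holds (fun x => swapWord a b c k (h x)) ↔ g.Holds h)),
      ∃ C : ℕ, ∀ h : Subst A, ∃ B : Finset ℕ, B.card ≤ C ∧ ∀ k, k ∉ B →
        (f.Holds (fun x => swapWord a b c k (h x)) ↔ f.Holds h) ∧
        (g.Holds (fun x => swapWord a b c k (h x)) ↔ g.Holds h) := by
    rintro f g ⟨C, hC⟩ ⟨D, hD⟩
    refine ⟨C + D, fun h => ?_⟩
    obtain ⟨B, hB, h1⟩ := hC h
    obtain ⟨B', hB', h2⟩ := hD h
    refine ⟨B ∪ B', (Finset.card_union_le _ _).trans (by omega), fun k hk => ?_⟩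
    simp only [Finset.mem_union, not_or] at hk
    exact ⟨h1 k hk.1, h2 k hk.2⟩
  induction f with
  | atom p =>
    rcases p with ⟨s, M⟩ | ⟨l₁, l₂⟩ | ⟨s₁, s₂⟩
    · simp [WELEN, AllAtoms, Atom.IsEq, Atom.IsLen] at hf
    · exact ⟨0, fun h => ⟨∅, by simp, fun k _ => by
        simp [Holds, Atom.Holds, LengthTerm.eval_swapWord]⟩⟩
    · refine ⟨4 * s₁.length + 4 * s₂.length, fun h => ?_⟩
      obtain ⟨B, hB, h1⟩ := Term.exists_swapWord_eval a b c s₁ h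
      obtain ⟨B', hB', h2⟩ := Term.exists_swapWord_eval a b c s₂ h
      refine ⟨B ∪ B', (Finset.card_union_le _ _).trans (by omega), fun k hk => ?_⟩
      simp only [Finset.mem_union, not_or] at hk
      simp only [Holds, Atom.Holds, h1 k hk.1, h2 k hk.2]
      exact (swapWord_injective hb hc k).eq_iff
  | neg f ih =>
    obtain ⟨C, hC⟩ := ih hf
    refine ⟨C, fun h => ?_⟩
    obtain ⟨B, hB, h1⟩ := hC h
    exact ⟨B, hB, fun k hk => not_congr (h1 k hk)⟩
  | and f g ihf ihg =>
    obtain ⟨C, hC⟩ := binary f g (ihf hf.1) (ihg hf.2)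
    refine ⟨C, fun h => (hC h).imp fun B hB => ⟨hB.1, fun k hk => ?_⟩⟩
    exact and_congr (hB.2 k hk).1 (hB.2 k hk).2
  | or f g ihf ihg =>
    obtain ⟨C, hC⟩ := binary f g (ihf hf.1) (ihg hf.2)
    refine ⟨C, fun h => (hC h).imp fun B hB => ⟨hB.1, fun k hk => ?_⟩⟩
    exact or_congr (hB.2 k hk).1 (hB.2 k hk).2
  | imp f g ihf ihg =>
    obtain ⟨C, hC⟩ := binary f g (ihf hf.1) (ihg hf.2)
    refine ⟨C, fun h => (hC h).imp fun B hB => ⟨hB.1, fun k hk => ?_⟩⟩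
    exact imp_congr (hB.2 k hk).1 (hB.2 k hk).2
  | iff f g ihf ihg =>
    obtain ⟨C, hC⟩ := binary f g (ihf hf.1) (ihg hf.2)
    refine ⟨C, fun h => (hC h).imp fun B hB => ⟨hB.1, fun k hk => ?_⟩⟩
    exact iff_congr (hB.2 k hk).1 (hB.2 k hk).2

end Swap

theorem not_expressible_starOf [Finite A] (S : Set A) (h1 : 1 < S.ncard) (h2 : S ⊂ Set.univ) :
    ¬ Expressible (WELEN A) (starOf S) := by
  rintro ⟨f, hf, x, -, hx⟩
  obtain ⟨a, ha, b, hbS, hab⟩ := (Set.one_lt_ncard S.toFinite).1 h1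
  obtain ⟨c, -, hc⟩ := Set.exists_of_ssubset h2
  have hac : a ≠ c := fun e => hc (e ▸ ha)
  obtain ⟨C, hC⟩ := f.exists_holds_swapWord hab hac hf
  -- One block `bᵏb` for each of `C + 1` values of `k`. As `C` does not depend on the substitution,
  -- `w` can be fixed before the substitution that produces it is known.
  set w : List A := (List.range (C + 1)).flatMap fun i => List.replicate (i + 1) b ++ [a] with hw
  have hwS : w ∈ f.lang x := by
    rw [hx]
    intro y hy
    simp only [hw, List.mem_flatMap, List.mem_append, List.mem_replicate, List.mem_singleton] at hy
    obtain ⟨i, -, ⟨-, rfl⟩ | rfl⟩ := hy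
    exacts [hbS, ha]
  obtain ⟨h, hxw, hh⟩ := hwS
  obtain ⟨B, hB, hk⟩ := hC h
  obtain ⟨k, hkC, hkB⟩ : ∃ k ∈ Finset.range (C + 1), k ∉ B := by
    by_contra! hcon
    have := Finset.card_le_card (show Finset.range (C + 1) ⊆ B from hcon)
    rw [Finset.card_range] at this
    omega
  have hmem : swapWord a b c k w ∈ starOf S := by
    rw [← hx]
    exact ⟨_, by simp [hxw], (hk k hkB).2 hh⟩
  refine hc (hmem c ?_)
  rw [swapWord, hw, swapFrom_flatMap hab]
  refine List.mem_append_left _ (List.mem_flatMap.2 ⟨k, by simpa using hkC, ?_⟩)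
  simp [swapBlock, List.replicate_succ']

theorem subsetUniversalityDecidable_WELEN [Finite A] [Primcodable A] :
    SubsetUniversalityDecidable (WELEN A) := by
  refine ⟨fun _ => false, Computable.const false, ?_⟩
  rintro ⟨⟨f, x⟩, l⟩ ⟨hf, hx, h1, h2⟩
  simp only [Bool.false_eq_true, false_iff]
  exact fun e => not_expressible_starOf _ h1 h2 ⟨f, hf, x, hx, e⟩

/-! ### Regular codes with separators -/

section Encoding

theorem append_cons_inj_of_notMem_left {s : A} {x y u v : List A} (hx : s ∉ x) (hy : s ∉ y)
    (h : x ++ s :: u = y ++ s :: v) : x = y ∧ u = v := by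
  induction x generalizing y with
  | nil =>
    rcases y with _ | ⟨b, y⟩
    · simpa using h
    · exact absurd (List.mem_cons.2 (.inl (List.cons.inj h).1)) hy
  | cons a x ih =>
    simp only [List.mem_cons, not_or] at hx
    rcases y with _ | ⟨b, y⟩
    · exact absurd (List.cons.inj h).1.symm hx.1
    · simp only [List.cons_append, List.cons.injEq, List.mem_cons, not_or] at h hy
      obtain ⟨h1, h2⟩ := ih hx.2 hy.2 h.2
      exact ⟨by rw [h.1, h1], h2⟩

/-- The concatenation of the codes of the members of a list, each followed by the separator `s`. -/
def sepConcat {α : Type*} (s : A) (e : α → List A) (l : List α) : List A :=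
  l.flatMap fun a => e a ++ [s]

variable {α : Type*} {s : A} {e : α → List A}

@[simp] theorem sepConcat_nil : sepConcat s e [] = [] := rfl

@[simp] theorem sepConcat_cons (a : α) (l : List α) :
    sepConcat s e (a :: l) = e a ++ s :: sepConcat s e l := by
  simp [sepConcat]

@[simp] theorem sepConcat_append (l l' : List α) :
    sepConcat s e (l ++ l') = sepConcat s e l ++ sepConcat s e l' := by
  simp [sepConcat]

theorem sepConcat_injective (hs : ∀ a, s ∉ e a) (he : Function.Injective e) :
    Function.Injective (sepConcat s e) := by
  intro l
  induction l with
  | nil => rintro (_ | ⟨b, l'⟩) h <;> simp_all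
  | cons a l ih =>
    rintro (_ | ⟨b, l'⟩) h
    · simp at h
    · rw [sepConcat_cons, sepConcat_cons] at h
      obtain ⟨h1, h2⟩ := append_cons_inj_of_notMem_left (hs a) (hs b) h
      rw [he h1, ih h2]

theorem mem_sepConcat {t : A} {l : List α} (h : t ∈ sepConcat s e l) :
    t = s ∨ ∃ a ∈ l, t ∈ e a := by
  simp only [sepConcat, List.mem_flatMap, List.mem_append, List.mem_singleton] at h
  obtain ⟨a, ha, h | h⟩ := h
  exacts [.inr ⟨a, ha, h⟩, .inl h]

open Classical in
/-- An automaton for the concatenations of words that are accepted by `M` and do not contain `s`,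
each followed by `s`. The state `none` is a sink, `some none` stands for the start of a block. -/
noncomputable def sepDFA {σ : Type*} (s : A) (M : DFA A σ) : DFA A (Option (Option σ)) where
  step p x := p.bind fun q =>
    if x = s then (if q.getD M.start ∈ M.accept then some none else none)
    else some (some (M.step (q.getD M.start) x))
  start := some none
  accept := {some none}

theorem sepDFA_evalFrom_none {σ : Type*} (M : DFA A σ) (w : List A) :
    (sepDFA s M).evalFrom none w = none := by
  induction w with
  | nil => rfl
  | cons x w ih => rw [DFA.evalFrom_cons]; exact ih

/-- The word `y` is the unread rest of the current block, which `M` has to complete from its present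
state; complete blocks follow. At `q = none` nothing of the block has been read, and `getD` supplies
the start of `M`. -/
theorem sepDFA_evalFrom_some {σ : Type*} (hs : ∀ a, s ∉ e a) (M : DFA A σ)
    (hM : ∀ w, w ∈ M.accepts ↔ ∃ a, e a = w) (w : List A) (q : Option σ) :
    (sepDFA s M).evalFrom (some q) w = some none ↔ (w = [] ∧ q = none) ∨
      ∃ y l, w = y ++ s :: sepConcat s e l ∧ s ∉ y ∧
        M.evalFrom (q.getD M.start) y ∈ M.accept := by
  induction w generalizing q with
  | nil => simp
  | cons x w ih =>
    rw [DFA.evalFrom_cons]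
    by_cases hx : x = s
    · subst hx
      by_cases hq : q.getD M.start ∈ M.accept
      · have e1 : (sepDFA x M).step (some q) x = some none := by simp [sepDFA, hq]
        rw [e1, ih]
        constructor
        · rintro (⟨rfl, -⟩ | ⟨y, l, rfl, hy, hacc⟩)
          · exact .inr ⟨[], [], by simp, by simp, hq⟩
          · obtain ⟨a, rfl⟩ := (hM y).1 hacc
            exact .inr ⟨[], a :: l, by simp, by simp, hq⟩
        · rintro (h | ⟨y, l, h, hy, -⟩)
          · simp at h
          · rcases y with _ | ⟨b, y⟩
            · rcases l with _ | ⟨a, l⟩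
              · simp_all
              · simp only [List.nil_append, sepConcat_cons, List.cons.injEq, true_and] at h
                exact .inr ⟨e a, l, h, hs a, (hM _).2 ⟨a, rfl⟩⟩
            · simp_all
      · have e1 : (sepDFA x M).step (some q) x = none := by simp [sepDFA, hq]
        rw [e1, sepDFA_evalFrom_none]
        simp only [reduceCtorEq, false_and, false_or, false_iff]
        rintro ⟨_ | ⟨b, y⟩, l, h, hy, h'⟩
        · exact hq h'
        · simp_all
    · have e1 : (sepDFA s M).step (some q) x = some (some (M.step (q.getD M.start) x)) := by
        simp [sepDFA, hx]
      rw [e1, ih]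
      simp only [reduceCtorEq, and_false, false_and, false_or, Option.getD_some]
      constructor
      · rintro ⟨y, l, rfl, hy, h⟩
        exact ⟨x :: y, l, by simp, by simp [hy, Ne.symm hx], by rwa [DFA.evalFrom_cons]⟩
      · rintro ⟨_ | ⟨b, y⟩, l, h, hy, h'⟩
        · simp_all
        · simp only [List.cons_append, List.cons.injEq, List.mem_cons, not_or] at *
          obtain ⟨rfl, rfl⟩ := h
          exact ⟨y, l, rfl, hy.2, by rwa [DFA.evalFrom_cons] at h'⟩

theorem isRegular_range_sepConcat (hs : ∀ a, s ∉ e a)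
    (h : Language.IsRegular (Set.range e : Set (List A))) :
    Language.IsRegular (Set.range (sepConcat s e) : Set (List A)) := by
  obtain ⟨σ, _, M, hM⟩ := h
  have hM' : ∀ w, w ∈ M.accepts ↔ ∃ a, e a = w := fun w => by rw [hM]; rfl
  refine ⟨Option (Option σ), inferInstance, sepDFA s M, ?_⟩
  ext w
  refine ((sepDFA_evalFrom_some hs M hM' w none).trans ?_)
  constructor
  · rintro (⟨rfl, -⟩ | ⟨y, l, rfl, -, h⟩)
    · exact ⟨[], rfl⟩
    · obtain ⟨a, rfl⟩ := (hM' y).1 h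
      exact ⟨a :: l, by simp⟩
  · rintro ⟨_ | ⟨a, l⟩, rfl⟩
    · exact .inl ⟨rfl, rfl⟩
    · exact .inr ⟨e a, l, by simp, hs a, (hM' _).2 ⟨a, rfl⟩⟩

theorem exists_automaton [Finite A] {L : Language A} (hL : L.IsRegular) :
    ∃ M : Automaton A, (Automaton.toNFA M).accepts = L := by
  classical
  obtain ⟨σ, _, M, rfl⟩ := hL
  have := Fintype.ofFinite A
  let c : σ → ℕ := fun q => Fintype.equivFin σ q
  have hc : Function.Injective c := fun p q h => (Fintype.equivFin σ).injective (Fin.ext h)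
  let N : Automaton A := ([c M.start], (Finset.univ.toList.filter (· ∈ M.accept)).map c,
    (Finset.univ : Finset (σ × A)).toList.map fun p => (c p.1, p.2, c (M.step p.1 p.2)))
  have hstep (q : σ) (a : A) : (Automaton.toNFA N).step (c q) a = {c (M.step q a)} := by
    ext p
    simp only [Automaton.toNFA, N, Set.mem_ofPred_eq, List.mem_map, Finset.mem_toList,
      Finset.mem_univ, true_and, Prod.mk.injEq, Prod.exists, Set.mem_singleton_iff]
    constructor
    · rintro ⟨q', a', h1, rfl, rfl⟩
      rw [hc h1]
    · rintro rfl
      exact ⟨q, a, rfl, rfl, rfl⟩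
  have heval (w : List A) (q : σ) :
      (Automaton.toNFA N).evalFrom {c q} w = {c (M.evalFrom q w)} := by
    induction w generalizing q with
    | nil => rfl
    | cons a w ih =>
      rw [NFA.evalFrom_cons, NFA.stepSet_singleton, hstep, ih, DFA.evalFrom_cons]
  refine ⟨N, ?_⟩
  ext w
  have hstart : (Automaton.toNFA N).start = {c M.start} := by
    ext p
    simp [Automaton.toNFA, N]
  rw [NFA.mem_accepts, hstart, heval, DFA.mem_accepts]
  constructor
  · rintro ⟨p, hp, rfl⟩
    simp only [Automaton.toNFA, N, Set.mem_ofPred_eq, List.mem_map, List.mem_filter,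
      decide_eq_true_eq] at hp
    obtain ⟨q, ⟨-, hq⟩, e⟩ := hp
    rwa [hc e] at hq
  · intro h
    exact ⟨_, by simpa [Automaton.toNFA, N] using ⟨_, h, rfl⟩, rfl⟩

theorem isRegular_starOf (S : Set A) : (starOf S).IsRegular := by
  classical
  refine ⟨Bool, inferInstance, ⟨fun q a => q && decide (a ∈ S), true, {true}⟩, ?_⟩
  have key : ∀ (w : List A) (q : Bool),
      w.foldl (fun q a => q && decide (a ∈ S)) q = true ↔ q = true ∧ ∀ a ∈ w, a ∈ S := by
    intro w
    induction w with
    | nil => simp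
    | cons a w ih => intro q; simp [ih, and_assoc]
  ext w
  exact (key w true).trans (by simp [starOf]; rfl)

end Encoding

/-! ### A stack machine for partial recursive codes -/

section Machine

open Turing.ToPartrec Relation

/-- Instructions of a stack machine that evaluates codes: evaluate a code at the current list;
evaluate the second component of a `Code.cons`; prepend the head of a stored list; test whether a
loop is left. -/
inductive Instr : Type
  | run (c : Code)
  | second (fs : Code)
  | push
  | loop (f : Code)

/-- The new current list and the instructions (with stored lists) that replace the instruction `i`
with stored list `d` when the current list is `v`. -/
def Instr.effect : Instr → List ℕ → List ℕ → List ℕ × List (Instr × List ℕ)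
  | .run .zero', _, v => (0 :: v, [])
  | .run .succ, _, v => ([v.headI + 1], [])
  | .run .tail, _, v => (v.tail, [])
  | .run (.cons f fs), _, v => (v, [(.run f, []), (.second fs, v)])
  | .run (.comp f g), _, v => (v, [(.run g, []), (.run f, [])])
  | .run (.case f g), _, v =>
    if v.headI = 0 then (v.tail, [(.run f, [])]) else ((v.headI - 1) :: v.tail, [(.run g, [])])
  | .run (.fix f), _, v => (v, [(.run f, []), (.loop f, [])])
  | .second fs, d, v => (d, [(.run fs, []), (.push, v)])
  | .push, d, v => (d.headI :: v, [])
  | .loop f, _, v =>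
    if v.headI = 0 then (v.tail, []) else (v.tail, [(.run f, []), (.loop f, [])])

/-- A list of instructions that is closed under execution. -/
def Instr.Closed (T : List Instr) : Prop := ∀ i ∈ T, ∀ d v, ∀ p ∈ (i.effect d v).2, p.1 ∈ T

/-- Only subcodes of `c` are ever pushed. This finiteness is what lets one formula list all possible
steps. -/
theorem Instr.exists_closed (c : Code) : ∃ T : List Instr, .run c ∈ T ∧ Closed T := by
  have single (i : Instr) (h : ∀ d v, (i.effect d v).2 = []) : Closed [i] := by
    intro j hj d v p hp
    obtain rfl := List.mem_singleton.1 hj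
    simp [h] at hp
  induction c with
  | zero' => exact ⟨[.run .zero'], by simp, single _ fun _ _ => rfl⟩
  | succ => exact ⟨[.run .succ], by simp, single _ fun _ _ => rfl⟩
  | tail => exact ⟨[.run .tail], by simp, single _ fun _ _ => rfl⟩
  | cons f fs ihf ihfs =>
    obtain ⟨T, hf, hT⟩ := ihf
    obtain ⟨T', hfs, hT'⟩ := ihfs
    refine ⟨.run (.cons f fs) :: .second fs :: .push :: (T ++ T'), by simp, ?_⟩
    intro i hi d v p hp
    simp only [List.mem_cons, List.mem_append] at hi ⊢
    rcases hi with rfl | rfl | rfl | hi | hi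
    · simp only [effect, List.mem_cons, List.not_mem_nil, or_false] at hp
      rcases hp with rfl | rfl <;> simp [hf]
    · simp only [effect, List.mem_cons, List.not_mem_nil, or_false] at hp
      rcases hp with rfl | rfl <;> simp [hfs]
    · simp [effect] at hp
    · simp [hT i hi d v p hp]
    · simp [hT' i hi d v p hp]
  | comp f g ihf ihg =>
    obtain ⟨T, hf, hT⟩ := ihf
    obtain ⟨T', hg, hT'⟩ := ihg
    refine ⟨.run (.comp f g) :: (T ++ T'), by simp, ?_⟩
    intro i hi d v p hp
    simp only [List.mem_cons, List.mem_append] at hi ⊢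
    rcases hi with rfl | hi | hi
    · simp only [effect, List.mem_cons, List.not_mem_nil, or_false] at hp
      rcases hp with rfl | rfl <;> simp [hf, hg]
    · simp [hT i hi d v p hp]
    · simp [hT' i hi d v p hp]
  | case f g ihf ihg =>
    obtain ⟨T, hf, hT⟩ := ihf
    obtain ⟨T', hg, hT'⟩ := ihg
    refine ⟨.run (.case f g) :: (T ++ T'), by simp, ?_⟩
    intro i hi d v p hp
    simp only [List.mem_cons, List.mem_append] at hi ⊢
    rcases hi with rfl | hi | hi
    · simp only [effect] at hp
      split_ifs at hp <;> simp_all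
    · simp [hT i hi d v p hp]
    · simp [hT' i hi d v p hp]
  | fix f ihf =>
    obtain ⟨T, hf, hT⟩ := ihf
    refine ⟨.run (.fix f) :: .loop f :: T, by simp, ?_⟩
    intro i hi d v p hp
    simp only [List.mem_cons] at hi ⊢
    rcases hi with rfl | rfl | hi
    · simp only [effect, List.mem_cons, List.not_mem_nil, or_false] at hp
      rcases hp with rfl | rfl <;> simp [hf]
    · simp only [effect] at hp
      split_ifs at hp
      · simp at hp
      · simp only [List.mem_cons, List.not_mem_nil, or_false] at hp
        rcases hp with rfl | rfl <;> simp [hf]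
    · simp [hT i hi d v p hp]

/-- Configurations: the current list, followed by the stack of pending instructions. An instruction
is given as the list of its stored data, headed by its number. The halted configuration is `[]`. -/
abbrev Config : Type := List (List ℕ)

/-- The number of an instruction, followed by its stored list. -/
def frame (tag : Instr → ℕ) (p : Instr × List ℕ) : List ℕ := tag p.1 :: p.2

/-- One step of the machine with instruction set `T`. -/
inductive MStep (tag : Instr → ℕ) (T : List Instr) : Config → Config → Prop
  | halt (v : List ℕ) : MStep tag T [v] []
  | exec {i : Instr} (hi : i ∈ T) (d v : List ℕ) (k : Config) : MStep tag T
      (v :: (tag i :: d) :: k) ((i.effect d v).1 :: ((i.effect d v).2.map (frame tag) ++ k))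

variable {tag : Instr → ℕ} {T : List Instr}

theorem MStep.unique (htag : Set.InjOn tag {i | i ∈ T}) {x y z : Config}
    (h : MStep tag T x y) (h' : MStep tag T x z) : y = z := by
  rcases h with v | @⟨i, hi, d, v, k⟩
  · cases h'
    rfl
  · generalize hx : (v :: (tag i :: d) :: k) = x at h'
    rcases h' with v' | @⟨j, hj, d', v', k'⟩
    · simp at hx
    · simp only [List.cons.injEq] at hx
      obtain ⟨rfl, ⟨e, rfl⟩, rfl⟩ := hx
      rw [htag hi hj e]

/-- A sequence of configurations that ends with the halted one and follows the machine wherever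
it makes a step. -/
def Trace (tag : Instr → ℕ) (T : List Instr) : List Config → Prop
  | [] => False
  | [x] => x = []
  | x :: y :: l => (∀ z, MStep tag T x z → y = z) ∧ Trace tag T (y :: l)

theorem Trace.exists_of_step {x z : Config} {l : List Config} (h : Trace tag T (x :: l))
    (hz : MStep tag T x z) : ∃ l', l = z :: l' ∧ Trace tag T (z :: l') := by
  rcases l with _ | ⟨y, l⟩
  · obtain rfl : x = [] := h
    cases hz
  · obtain rfl := h.1 z hz
    exact ⟨l, rfl, h.2⟩

theorem Trace.exists_of_mem {i : Instr} (hi : i ∈ T) {d v : List ℕ} {k : Config}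
    {l : List Config} (h : Trace tag T ((v :: (tag i :: d) :: k) :: l)) :
    ∃ l', l'.length < l.length ∧
      Trace tag T (((i.effect d v).1 :: ((i.effect d v).2.map (frame tag) ++ k)) :: l') := by
  obtain ⟨l', rfl, h'⟩ := h.exists_of_step (.exec hi d v k)
  exact ⟨l', by simp, h'⟩

/-- A trace may continue arbitrarily after a stuck configuration, but running a code from `T` never
gets stuck. The strict decrease of the remaining trace is what forces the loops of `fix` to
terminate. -/
theorem Trace.exists_eval (hT : Instr.Closed T) (c : Code) (hc : .run c ∈ T) (v : List ℕ)
    (k : Config) (l : List Config) (h : Trace tag T ((v :: [tag (.run c)] :: k) :: l)) :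
    ∃ w ∈ c.eval v, ∃ l', l'.length < l.length ∧ Trace tag T ((w :: k) :: l') := by
  induction c generalizing v k l with
  | zero' => exact ⟨0 :: v, by simp [Code.zero'_eval], h.exists_of_mem hc⟩
  | succ => exact ⟨[v.headI + 1], by simp [Code.succ_eval], h.exists_of_mem hc⟩
  | tail => exact ⟨v.tail, by simp [Code.tail_eval], h.exists_of_mem hc⟩
  | cons f fs ihf ihfs =>
    have m1 : .run f ∈ T := hT _ hc [] v (.run f, []) (by simp [Instr.effect])
    have m2 : .second fs ∈ T := hT _ hc [] v (.second fs, v) (by simp [Instr.effect])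
    have m3 : .run fs ∈ T := hT _ m2 [] v (.run fs, []) (by simp [Instr.effect])
    have m4 : .push ∈ T := hT _ m2 [] v (.push, v) (by simp [Instr.effect])
    obtain ⟨l1, h1, t1⟩ := h.exists_of_mem hc
    obtain ⟨w, hw, l2, h2, t2⟩ := ihf m1 _ _ _ t1
    obtain ⟨l3, h3, t3⟩ := t2.exists_of_mem m2
    obtain ⟨w', hw', l4, h4, t4⟩ := ihfs m3 _ _ _ t3
    obtain ⟨l5, h5, t5⟩ := t4.exists_of_mem m4
    refine ⟨w.headI :: w', ?_, l5, by omega, t5⟩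
    simp only [Code.cons_eval, Part.bind_eq_bind, Part.mem_bind_iff, Part.pure_eq_some,
      Part.mem_some_iff]
    exact ⟨w, hw, w', hw', rfl⟩
  | comp f g ihf ihg =>
    have m1 : .run f ∈ T := hT _ hc [] v (.run f, []) (by simp [Instr.effect])
    have m2 : .run g ∈ T := hT _ hc [] v (.run g, []) (by simp [Instr.effect])
    obtain ⟨l1, h1, t1⟩ := h.exists_of_mem hc
    obtain ⟨w, hw, l2, h2, t2⟩ := ihg m2 _ _ _ t1
    obtain ⟨w', hw', l3, h3, t3⟩ := ihf m1 _ _ _ t2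
    refine ⟨w', ?_, l3, by omega, t3⟩
    rw [Code.comp_eval]
    exact Part.mem_bind_iff.2 ⟨w, hw, hw'⟩
  | case f g ihf ihg =>
    have m1 : .run f ∈ T := hT _ hc [] [] (.run f, []) (by simp [Instr.effect])
    have m2 : .run g ∈ T := hT _ hc [] [1] (.run g, []) (by simp [Instr.effect])
    obtain ⟨l1, h1, t1⟩ := h.exists_of_mem hc
    rw [Code.case_eval]
    rcases hv : v.headI with _ | n
    · simp only [Instr.effect, hv, if_true] at t1
      obtain ⟨w, hw, l2, h2, t2⟩ := ihf m1 _ _ _ t1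
      exact ⟨w, by simpa [hv] using hw, l2, by omega, t2⟩
    · simp only [Instr.effect, hv, Nat.add_eq_zero_iff, one_ne_zero, and_false, if_false,
        Nat.add_sub_cancel] at t1
      obtain ⟨w, hw, l2, h2, t2⟩ := ihg m2 _ _ _ t1
      exact ⟨w, by simpa [hv] using hw, l2, by omega, t2⟩
  | fix f ihf =>
    have m1 : .run f ∈ T := hT _ hc [] v (.run f, []) (by simp [Instr.effect])
    have m2 : .loop f ∈ T := hT _ hc [] v (.loop f, []) (by simp [Instr.effect])
    -- The induction on the code does not cover repeated passes through the loop; those are handled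
    -- by induction on a bound for the remaining length.
    have loop : ∀ (n : ℕ) (v : List ℕ) (l : List Config), l.length ≤ n →
        Trace tag T ((v :: [tag (.run f)] :: [tag (.loop f)] :: k) :: l) →
        ∃ w ∈ (Code.fix f).eval v, ∃ l', l'.length < l.length ∧ Trace tag T ((w :: k) :: l') := by
      intro n
      induction n with
      | zero =>
        intro v l hl h
        obtain ⟨w, -, l1, h1, -⟩ := ihf m1 _ _ _ h
        omega
      | succ n ih =>
        intro v l hl h
        obtain ⟨w, hw, l1, h1, t1⟩ := ihf m1 _ _ _ h
        obtain ⟨l2, h2, t2⟩ := t1.exists_of_mem m2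
        rw [Code.fix_eval]
        by_cases hv : w.headI = 0
        · simp only [Instr.effect, hv, if_true] at t2
          refine ⟨w.tail, PFun.mem_fix_iff.2 (.inl ?_), l2, by omega, t2⟩
          exact (Part.mem_map_iff _).2 ⟨w, hw, by simp [hv]⟩
        · simp only [Instr.effect, hv, if_false] at t2
          obtain ⟨w', hw', l3, h3, t3⟩ := ih _ _ (by omega) t2
          rw [Code.fix_eval] at hw'
          refine ⟨w', PFun.mem_fix_iff.2 (.inr ⟨w.tail, ?_, hw'⟩), l3, by omega, t3⟩
          exact (Part.mem_map_iff _).2 ⟨w, hw, by simp [hv]⟩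
    obtain ⟨l1, h1, t1⟩ := h.exists_of_mem hc
    obtain ⟨w, hw, l2, h2, t2⟩ := loop _ _ _ le_rfl t1
    exact ⟨w, hw, l2, by omega, t2⟩

theorem reaches_of_mem_eval (hT : Instr.Closed T) (c : Code) (hc : .run c ∈ T) {v w : List ℕ}
    (k : Config) (h : w ∈ c.eval v) :
    ReflTransGen (MStep tag T) (v :: [tag (.run c)] :: k) (w :: k) := by
  have step {i : Instr} (hi : i ∈ T) (d v : List ℕ) (k : Config) :=
    ReflTransGen.single (MStep.exec (tag := tag) hi d v k)
  induction c generalizing v w k with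
  | zero' =>
    obtain rfl : w = 0 :: v := by simpa [Code.zero'_eval] using h
    exact step hc [] v k
  | succ =>
    obtain rfl : w = [v.headI + 1] := by simpa [Code.succ_eval] using h
    exact step hc [] v k
  | tail =>
    obtain rfl : w = v.tail := by simpa [Code.tail_eval] using h
    exact step hc [] v k
  | cons f fs ihf ihfs =>
    have m1 : .run f ∈ T := hT _ hc [] v (.run f, []) (by simp [Instr.effect])
    have m2 : .second fs ∈ T := hT _ hc [] v (.second fs, v) (by simp [Instr.effect])
    have m3 : .run fs ∈ T := hT _ m2 [] v (.run fs, []) (by simp [Instr.effect])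
    have m4 : .push ∈ T := hT _ m2 [] v (.push, v) (by simp [Instr.effect])
    simp only [Code.cons_eval, Part.bind_eq_bind, Part.mem_bind_iff, Part.pure_eq_some,
      Part.mem_some_iff] at h
    obtain ⟨x, hx, y, hy, rfl⟩ := h
    exact (step hc [] v k).trans <| (ihf m1 _ hx).trans <| (step m2 v x k).trans <|
      (ihfs m3 _ hy).trans <| step m4 x y k
  | comp f g ihf ihg =>
    have m1 : .run f ∈ T := hT _ hc [] v (.run f, []) (by simp [Instr.effect])
    have m2 : .run g ∈ T := hT _ hc [] v (.run g, []) (by simp [Instr.effect])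
    rw [Code.comp_eval] at h
    obtain ⟨x, hx, hw⟩ := Part.mem_bind_iff.1 h
    exact (step hc [] v k).trans <| (ihg m2 _ hx).trans <| ihf m1 _ hw
  | case f g ihf ihg =>
    have m1 : .run f ∈ T := hT _ hc [] [] (.run f, []) (by simp [Instr.effect])
    have m2 : .run g ∈ T := hT _ hc [] [1] (.run g, []) (by simp [Instr.effect])
    rw [Code.case_eval] at h
    have s := step hc [] v k
    rcases hv : v.headI with _ | n
    · simp only [Instr.effect, hv, if_true] at s h
      exact s.trans (ihf m1 _ h)
    · simp only [Instr.effect, hv, Nat.add_eq_zero_iff, one_ne_zero, and_false, if_false,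
        Nat.add_sub_cancel] at s h
      exact s.trans (ihg m2 _ h)
  | fix f ihf =>
    have m1 : .run f ∈ T := hT _ hc [] v (.run f, []) (by simp [Instr.effect])
    have m2 : .loop f ∈ T := hT _ hc [] v (.loop f, []) (by simp [Instr.effect])
    rw [Code.fix_eval] at h
    refine (step hc [] v k).trans ?_
    -- Induction over the passes of the loop, with the final result `w` kept fixed.
    refine PFun.fixInduction' (C := fun v => ReflTransGen (MStep tag T)
      (v :: [tag (.run f)] :: [tag (.loop f)] :: k) (w :: k)) h ?_ ?_
    · intro v h
      obtain ⟨x, hx, e⟩ := (Part.mem_map_iff _).1 h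
      split_ifs at e with hx0
      have s := step m2 [] x k
      simp only [Instr.effect, hx0, if_true, Sum.inl.inj e] at s
      exact (ihf m1 _ hx).trans s
    · intro v v' _ h ih
      obtain ⟨x, hx, e⟩ := (Part.mem_map_iff _).1 h
      split_ifs at e with hx0
      have s := step m2 [] x k
      simp only [Instr.effect, hx0, if_false, Sum.inr.inj e] at s
      exact (ihf m1 _ hx).trans (s.trans ih)

theorem exists_trace_iff (htag : Set.InjOn tag {i | i ∈ T}) (hT : Instr.Closed T) (c : Code)
    (hc : .run c ∈ T) (v : List ℕ) :
    (∃ l, Trace tag T ([v, [tag (.run c)]] :: l)) ↔ (c.eval v).Dom := by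
  constructor
  · rintro ⟨l, h⟩
    obtain ⟨w, hw, -⟩ := h.exists_eval hT c hc
    exact Part.dom_iff_mem.2 ⟨w, hw⟩
  · intro h
    obtain ⟨w, hw⟩ := Part.dom_iff_mem.1 h
    have hr : ReflTransGen (MStep tag T) [v, [tag (.run c)]] [] :=
      (reaches_of_mem_eval hT c hc [] hw).tail (.halt w)
    generalize [v, [tag (.run c)]] = x at hr
    induction hr using ReflTransGen.head_induction_on with
    | refl => exact ⟨[], rfl⟩
    | head hxy _ ih =>
      obtain ⟨l, hl⟩ := ih
      -- Determinism: the configuration reached is the only admissible successor.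
      exact ⟨_ :: l, fun z hz => hxy.unique htag hz, hl⟩

/-- Failure is local, with a decomposition of `H` as witness; this is the existential form that word
variables can express. -/
theorem not_trace_iff (H : List Config) : ¬ Trace tag T H ↔
    H = [] ∨ (∃ u d, d ≠ [] ∧ H = u ++ [d]) ∨
      ∃ u x y v z, H = u ++ x :: y :: v ∧ MStep tag T x z ∧ y ≠ z := by
  induction H with
  | nil => simp [Trace]
  | cons x l ih =>
    rcases l with _ | ⟨y, l⟩
    · simp only [Trace, List.cons_ne_nil, false_or]
      constructor
      · exact fun h => .inl ⟨[], x, h, rfl⟩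
      · rintro (⟨u, d, hd, h⟩ | ⟨u, x, y, v, z, h, -⟩)
        · rcases u with _ | ⟨b, u⟩ <;> simp_all
        · rcases u with _ | ⟨b, u⟩ <;> simp_all
    · rw [Trace, not_and_or, ih]
      simp only [List.cons_ne_nil, false_or]
      constructor
      · rintro (h | ⟨u, d, hd, h⟩ | ⟨u, x', y', v, z, h, hz⟩)
        · push Not at h
          obtain ⟨z, hz, hy⟩ := h
          exact .inr ⟨[], x, y, l, z, rfl, hz, hy⟩
        · exact .inl ⟨x :: u, d, hd, by rw [h]; rfl⟩
        · exact .inr ⟨x :: u, x', y', v, z, by rw [h]; rfl, hz⟩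
      · rintro (⟨_ | ⟨b, u⟩, d, hd, h⟩ | ⟨_ | ⟨b, u⟩, x', y', v, z, h, hz, hy⟩)
        · simp at h
        · exact .inr (.inl ⟨u, d, hd, (List.cons.inj h).2⟩)
        · simp only [List.nil_append, List.cons.injEq] at h
          obtain ⟨rfl, rfl, rfl⟩ := h
          exact .inl fun h => hy (h z hz)
        · exact .inr (.inr ⟨u, x', y', v, z, (List.cons.inj h).2, hz, hy⟩)

end Machine

/-! ### Relations definable in WE+REG -/

section Definability

/-- The set of substitutions is the set of solutions of a formula of WE+REG. -/
def Definable (P : Subst A → Prop) : Prop := ∃ f ∈ WEREG A, ∀ h, f.Holds h ↔ P h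

theorem Definable.and {P Q : Subst A → Prop} (hP : Definable P) (hQ : Definable Q) :
    Definable fun h => P h ∧ Q h := by
  obtain ⟨f, hf, hf'⟩ := hP
  obtain ⟨g, hg, hg'⟩ := hQ
  exact ⟨.and f g, ⟨hf, hg⟩, fun h => and_congr (hf' h) (hg' h)⟩

theorem Definable.or {P Q : Subst A → Prop} (hP : Definable P) (hQ : Definable Q) :
    Definable fun h => P h ∨ Q h := by
  obtain ⟨f, hf, hf'⟩ := hP
  obtain ⟨g, hg, hg'⟩ := hQ
  exact ⟨.or f g, ⟨hf, hg⟩, fun h => or_congr (hf' h) (hg' h)⟩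

theorem Definable.not {P : Subst A → Prop} (hP : Definable P) : Definable fun h => ¬ P h := by
  obtain ⟨f, hf, hf'⟩ := hP
  exact ⟨.neg f, hf, fun h => not_congr (hf' h)⟩

theorem Definable.eq (s t : Term A) : Definable fun h => Term.eval h s = Term.eval h t :=
  ⟨.atom (.eq s t), .inl trivial, fun _ => Iff.rfl⟩

theorem Definable.mem [Finite A] {L : Language A} (hL : L.IsRegular) (x : ℕ) :
    Definable fun h : Subst A => h x ∈ L := by
  obtain ⟨M, hM⟩ := exists_automaton hL
  exact ⟨.atom (.mem [.inr x] M), .inr trivial, fun h => by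
    simp [Formula.Holds, Atom.Holds, Term.eval, hM]⟩

theorem Definable.exists_mem {ι : Type*} (l : List ι) {P : ι → Subst A → Prop}
    (hP : ∀ i ∈ l, Definable (P i)) : Definable fun h => ∃ i ∈ l, P i h := by
  induction l with
  | nil =>
    obtain ⟨f, hf, hf'⟩ := (Definable.eq (A := A) [] []).not
    exact ⟨f, hf, fun h => by simp [hf']⟩
  | cons i l ih =>
    obtain ⟨f, hf, hf'⟩ := (hP i (by simp)).or (ih fun j hj => hP j (by simp [hj]))
    exact ⟨f, hf, fun h => by simp [hf']⟩

theorem Definable.congr {P Q : Subst A → Prop} (hP : Definable P) (h : ∀ x, P x ↔ Q x) :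
    Definable Q := by
  obtain ⟨f, hf, hf'⟩ := hP
  exact ⟨f, hf, fun x => (hf' x).trans (h x)⟩

end Definability

/-! ### Computations as words over four letters -/

section Codes

variable (ℓ : Fin 4 → A)

/-- Unary code of a number. -/
def codeNat (n : ℕ) : List A := List.replicate n (ℓ 0)

/-- Code of a list of numbers. -/
def codeList : List ℕ → List A := sepConcat (ℓ 1) (codeNat ℓ)

/-- Code of a configuration. -/
def codeConfig : Config → List A := sepConcat (ℓ 2) (codeList ℓ)

/-- Code of a sequence of configurations. -/
def codeHistory : List Config → List A := sepConcat (ℓ 3) (codeConfig ℓ)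

theorem mem_codeNat {n : ℕ} {x : A} (h : x ∈ codeNat ℓ n) : x = ℓ 0 :=
  List.eq_of_mem_replicate h

theorem mem_codeList {v : List ℕ} {x : A} (h : x ∈ codeList ℓ v) : x = ℓ 1 ∨ x = ℓ 0 :=
  (mem_sepConcat h).imp_right fun ⟨_, _, h⟩ => mem_codeNat ℓ h

theorem mem_codeConfig {k : Config} {x : A} (h : x ∈ codeConfig ℓ k) :
    x = ℓ 2 ∨ x = ℓ 1 ∨ x = ℓ 0 :=
  (mem_sepConcat h).imp_right fun ⟨_, _, h⟩ => mem_codeList ℓ h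

theorem mem_codeHistory {H : List Config} {x : A} (h : x ∈ codeHistory ℓ H) :
    x = ℓ 3 ∨ x = ℓ 2 ∨ x = ℓ 1 ∨ x = ℓ 0 :=
  (mem_sepConcat h).imp_right fun ⟨_, _, h⟩ => mem_codeConfig ℓ h

theorem codeNat_eq_sepConcat (n : ℕ) :
    codeNat ℓ n = sepConcat (ℓ 0) (fun _ => []) (List.replicate n ()) := by
  induction n with
  | zero => rfl
  | succ n ih =>
    rw [List.replicate_succ, sepConcat_cons, ← ih, codeNat, List.replicate_succ]
    rfl

variable {ℓ}

theorem notMem_codeNat (hℓ : Function.Injective ℓ) (n : ℕ) : ℓ 1 ∉ codeNat ℓ n := fun h =>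
  absurd (hℓ (mem_codeNat ℓ h)) (by decide)

theorem notMem_codeList (hℓ : Function.Injective ℓ) (v : List ℕ) : ℓ 2 ∉ codeList ℓ v := fun h => by
  rcases mem_codeList ℓ h with h | h <;> exact absurd (hℓ h) (by decide)

theorem notMem_codeConfig (hℓ : Function.Injective ℓ) (k : Config) : ℓ 3 ∉ codeConfig ℓ k := fun h => by
  rcases mem_codeConfig ℓ h with h | h | h <;> exact absurd (hℓ h) (by decide)

theorem codeList_injective (hℓ : Function.Injective ℓ) : Function.Injective (codeList ℓ) :=
  sepConcat_injective (notMem_codeNat hℓ) fun m n h => by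
    simpa [codeNat] using congrArg List.length h

theorem codeConfig_injective (hℓ : Function.Injective ℓ) : Function.Injective (codeConfig ℓ) :=
  sepConcat_injective (notMem_codeList hℓ) (codeList_injective hℓ)

theorem codeHistory_injective (hℓ : Function.Injective ℓ) : Function.Injective (codeHistory ℓ) :=
  sepConcat_injective (notMem_codeConfig hℓ) (codeConfig_injective hℓ)

/-- A unary number is a list of empty codes, each followed by `ℓ 0`. Hence the result on `sepConcat`
applies, starting from the language of the empty word, which is `starOf ∅`. -/
theorem isRegular_codeNat (ℓ : Fin 4 → A) :
    Language.IsRegular (Set.range (codeNat ℓ) : Set (List A)) := by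
  have h0 : Language.IsRegular (Set.range (fun _ : Unit => ([] : List A)) : Set (List A)) := by
    have e : (Set.range (fun _ : Unit => ([] : List A)) : Set (List A)) = starOf (∅ : Set A) := by
      ext w
      rcases w with _ | ⟨a, w⟩
      · simp [starOf]
      · simp only [Set.range_const, Set.mem_singleton_iff, reduceCtorEq, false_iff]
        exact fun h => h a (by simp)
    rw [e]
    exact isRegular_starOf ∅
  suffices e : (Set.range (codeNat ℓ) : Set (List A)) =
      Set.range (sepConcat (ℓ 0) fun _ : Unit => []) by
    rw [e]
    exact isRegular_range_sepConcat (by simp) h0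
  ext w
  constructor
  · rintro ⟨n, rfl⟩
    exact ⟨_, (codeNat_eq_sepConcat ℓ n).symm⟩
  · rintro ⟨l, rfl⟩
    refine ⟨l.length, (codeNat_eq_sepConcat ℓ _).trans ?_⟩
    congr 1
    exact (List.eq_replicate_of_mem fun _ _ => rfl).symm

theorem isRegular_codeList (hℓ : Function.Injective ℓ) :
    Language.IsRegular (Set.range (codeList ℓ) : Set (List A)) :=
  isRegular_range_sepConcat (notMem_codeNat hℓ) (isRegular_codeNat ℓ)

theorem isRegular_codeConfig (hℓ : Function.Injective ℓ) :
    Language.IsRegular (Set.range (codeConfig ℓ) : Set (List A)) :=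
  isRegular_range_sepConcat (notMem_codeList hℓ) (isRegular_codeList hℓ)

theorem isRegular_codeHistory (hℓ : Function.Injective ℓ) :
    Language.IsRegular (Set.range (codeHistory ℓ) : Set (List A)) :=
  isRegular_range_sepConcat (notMem_codeConfig hℓ) (isRegular_codeConfig hℓ)

end Codes

/-! ### Machine steps as string terms -/

section Patterns

/-- Values of the variables in the description of a step of the machine. -/
structure Params : Type where
  n : ℕ
  m : ℕ
  v : List ℕ
  d : List ℕ
  k : Config

/-- The substitution maps the variables 1 to 5 to the codes of the parameters. -/
def Params.Coded (ℓ : Fin 4 → A) (h : Subst A) (p : Params) : Prop :=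
  h 1 = codeNat ℓ p.n ∧ h 2 = codeNat ℓ p.m ∧ h 3 = codeList ℓ p.v ∧ h 4 = codeList ℓ p.d ∧
    h 5 = codeConfig ℓ p.k

/-- The code of the value of `F` is given by a string term in the codes of the parameters. -/
def Representable {β : Type*} (ℓ : Fin 4 → A) (e : β → List A) (F : Params → β) : Prop :=
  ∃ t : Term A, ∀ h p, Params.Coded ℓ h p → Term.eval h t = e (F p)

theorem Term.eval_append (h : Subst A) (s t : Term A) :
    Term.eval h (s ++ t) = Term.eval h s ++ Term.eval h t := by
  simp [Term.eval]

theorem Term.eval_const (h : Subst A) (w : List A) : Term.eval h (w.map Sum.inl) = w := by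
  induction w with
  | nil => rfl
  | cons a w ih =>
    simp only [Term.eval] at ih
    simp [Term.eval, ih]

theorem Term.eval_var (h : Subst A) (x : ℕ) : Term.eval h [Sum.inr x] = h x := by
  simp [Term.eval]

variable {ℓ : Fin 4 → A} {β : Type*} {e : β → List A} {s : A}

theorem Representable.const (b : β) : Representable ℓ e fun _ => b :=
  ⟨(e b).map Sum.inl, fun h _ _ => Term.eval_const h _⟩

theorem Representable.cons {F : Params → β} {G : Params → List β} (hF : Representable ℓ e F)
    (hG : Representable ℓ (sepConcat s e) G) :
    Representable ℓ (sepConcat s e) fun p => F p :: G p := by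
  obtain ⟨t, ht⟩ := hF
  obtain ⟨t', ht'⟩ := hG
  refine ⟨t ++ ([s].map Sum.inl ++ t'), fun h p hp => ?_⟩
  rw [Term.eval_append, Term.eval_append, Term.eval_const, ht h p hp, ht' h p hp, sepConcat_cons]
  rfl

theorem Representable.succ {F : Params → ℕ} (hF : Representable ℓ (codeNat ℓ) F) :
    Representable ℓ (codeNat ℓ) fun p => F p + 1 := by
  obtain ⟨t, ht⟩ := hF
  refine ⟨t ++ [ℓ 0].map Sum.inl, fun h p hp => ?_⟩
  rw [Term.eval_append, Term.eval_const, ht h p hp, codeNat, codeNat, List.replicate_succ']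

theorem Representable.n : Representable ℓ (codeNat ℓ) Params.n :=
  ⟨[.inr 1], fun h _ hp => (Term.eval_var h 1).trans hp.1⟩

theorem Representable.m : Representable ℓ (codeNat ℓ) Params.m :=
  ⟨[.inr 2], fun h _ hp => (Term.eval_var h 2).trans hp.2.1⟩

theorem Representable.v : Representable ℓ (codeList ℓ) Params.v :=
  ⟨[.inr 3], fun h _ hp => (Term.eval_var h 3).trans hp.2.2.1⟩

theorem Representable.d : Representable ℓ (codeList ℓ) Params.d :=
  ⟨[.inr 4], fun h _ hp => (Term.eval_var h 4).trans hp.2.2.2.1⟩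

theorem Representable.k : Representable ℓ (codeConfig ℓ) Params.k :=
  ⟨[.inr 5], fun h _ hp => (Term.eval_var h 5).trans hp.2.2.2.2⟩

/-- The three shapes of the current list. -/
def currentShapes : List (Params → List ℕ) :=
  [fun _ => [], fun p => 0 :: p.v, fun p => (p.n + 1) :: p.v]

/-- The two shapes of the stored list. -/
def storedShapes : List (Params → List ℕ) := [fun _ => [], fun p => p.m :: p.d]

/-- The shapes separate the empty list, where `headI` is 0 by default, and the two kinds of head, so
that every operation on the list is a single term and the test for zero has a constant outcome. -/
theorem representable_currentShapes {V : Params → List ℕ} (hV : V ∈ currentShapes) :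
    Representable ℓ (codeList ℓ) V ∧ Representable ℓ (codeNat ℓ) (fun p => (V p).headI) ∧
    Representable ℓ (codeNat ℓ) (fun p => (V p).headI - 1) ∧
    Representable ℓ (codeList ℓ) (fun p => (V p).tail) ∧
    ((∀ p, (V p).headI = 0) ∨ ∀ p, (V p).headI ≠ 0) := by
  simp only [currentShapes, List.mem_cons, List.not_mem_nil, or_false] at hV
  rcases hV with rfl | rfl | rfl
  · exact ⟨.const _, .const _, .const _, .const _, .inl fun _ => rfl⟩
  · exact ⟨.cons (.const _) .v, .const _, .const _, .v, .inl fun _ => rfl⟩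
  · exact ⟨.cons (.succ .n) .v, .succ .n, .n, .v, .inr fun _ => Nat.succ_ne_zero _⟩

theorem representable_storedShapes {D : Params → List ℕ} (hD : D ∈ storedShapes) :
    Representable ℓ (codeList ℓ) D ∧ Representable ℓ (codeNat ℓ) (fun p => (D p).headI) := by
  simp only [storedShapes, List.mem_cons, List.not_mem_nil, or_false] at hD
  rcases hD with rfl | rfl
  · exact ⟨.const _, .const _⟩
  · exact ⟨.cons .m .d, .m⟩

/-- The configuration before the execution of the instruction `i`. -/
def before (tag : Instr → ℕ) (i : Instr) (V D : Params → List ℕ) (p : Params) : Config :=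
  V p :: (tag i :: D p) :: p.k

/-- The configuration after the execution of the instruction `i`. -/
def after (tag : Instr → ℕ) (i : Instr) (V D : Params → List ℕ) (p : Params) : Config :=
  (i.effect (D p) (V p)).1 :: ((i.effect (D p) (V p)).2.map (frame tag) ++ p.k)

theorem representable_before (tag : Instr → ℕ) (i : Instr) {V D : Params → List ℕ}
    (hV : V ∈ currentShapes) (hD : D ∈ storedShapes) :
    Representable ℓ (codeConfig ℓ) (before tag i V D) :=
  .cons (representable_currentShapes hV).1
    (.cons (.cons (.const _) (representable_storedShapes hD).1) .k)

/-- The rest `p.k` of the stack is untouched. Among the pushed frames only those of `second` and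
`push` store a list, namely the current one; all others are constant. -/
theorem representable_after (tag : Instr → ℕ) (i : Instr) {V D : Params → List ℕ}
    (hV : V ∈ currentShapes) (hD : D ∈ storedShapes) :
    Representable ℓ (codeConfig ℓ) (after tag i V D) := by
  obtain ⟨v1, v2, v3, v4, v5⟩ := representable_currentShapes (ℓ := ℓ) hV
  obtain ⟨d1, d2⟩ := representable_storedShapes (ℓ := ℓ) hD
  unfold after
  rcases i with (_ | _ | _ | ⟨f, fs⟩ | ⟨f, g⟩ | ⟨f, g⟩ | f) | fs | _ | f
  · exact .cons (.cons (.const 0) v1) .k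
  · exact .cons (.cons v2.succ (.const [])) .k
  · exact .cons v4 .k
  · exact .cons v1 (.cons (.const [_]) (.cons (.cons (.const (tag (.second fs))) v1) .k))
  · exact .cons v1 (.cons (.const [_]) (.cons (.const [_]) .k))
  · rcases v5 with v5 | v5
    · simp only [Instr.effect, v5, if_true]
      exact .cons v4 (.cons (.const [_]) .k)
    · simp only [Instr.effect, v5, if_false]
      exact .cons (.cons v3 v4) (.cons (.const [_]) .k)
  · exact .cons v1 (.cons (.const [_]) (.cons (.const [_]) .k))
  · exact .cons d1 (.cons (.const [_]) (.cons (.cons (.const (tag .push)) v1) .k))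
  · exact .cons (.cons d2 v1) .k
  · rcases v5 with v5 | v5
    · simp only [Instr.effect, v5, if_true]
      exact .cons v4 .k
    · simp only [Instr.effect, v5, if_false]
      exact .cons v4 (.cons (.const [_]) (.cons (.const [_]) .k))

end Patterns

/-! ### Describing the words that are not halting computations -/

section History

variable {ℓ : Fin 4 → A}

/-- Under the substitution, variable 0 is the code of a sequence in which a configuration `X p` is
followed by a configuration other than `Y p`. -/
def Violates (ℓ : Fin 4 → A) (X Y : Params → Config) (h : Subst A) : Prop :=
  ∃ p u d y, Params.Coded ℓ h p ∧ h 6 = codeHistory ℓ u ∧ h 7 = codeConfig ℓ d ∧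
    h 8 = codeHistory ℓ y ∧ h 0 = codeHistory ℓ (u ++ X p :: d :: y) ∧ d ≠ Y p

theorem codeHistory_append_cons_cons (u : List Config) (x d : Config) (y : List Config) :
    codeHistory ℓ (u ++ x :: d :: y) = codeHistory ℓ u ++ (codeConfig ℓ x ++ ([ℓ 3] ++
      (codeConfig ℓ d ++ ([ℓ 3] ++ codeHistory ℓ y)))) := by
  simp [codeHistory]

/-- The membership constraints force the variables to be codes, the equation places `X p` and `d`
next to each other in variable 0, and injectivity of the code turns `d ≠ Y p` into a disequation of
words. -/
theorem definable_violates [Finite A] (hℓ : Function.Injective ℓ) {X Y : Params → Config}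
    (hX : Representable ℓ (codeConfig ℓ) X) (hY : Representable ℓ (codeConfig ℓ) Y) :
    Definable (Violates ℓ X Y) := by
  obtain ⟨t, ht⟩ := hX
  obtain ⟨t', ht'⟩ := hY
  refine ((Definable.mem (isRegular_codeNat ℓ) 1).and <| (Definable.mem (isRegular_codeNat ℓ) 2).and <|
    (Definable.mem (isRegular_codeList hℓ) 3).and <|
    (Definable.mem (isRegular_codeList hℓ) 4).and <|
    (Definable.mem (isRegular_codeConfig hℓ) 5).and <|
    (Definable.mem (isRegular_codeHistory hℓ) 6).and <|
    (Definable.mem (isRegular_codeConfig hℓ) 7).and <|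
    (Definable.mem (isRegular_codeHistory hℓ) 8).and <|
    (Definable.eq [.inr 0] ([.inr 6] ++ (t ++ ([ℓ 3].map .inl ++ ([.inr 7] ++
      ([ℓ 3].map .inl ++ [.inr 8])))))).and (Definable.eq [.inr 7] t').not).congr fun h => ?_
  simp only [Term.eval_append, Term.eval_var, Term.eval_const]
  constructor
  · rintro ⟨⟨n, e1⟩, ⟨m, e2⟩, ⟨v, e3⟩, ⟨d, e4⟩, ⟨k, e5⟩, ⟨u, e6⟩, ⟨d', e7⟩, ⟨y, e8⟩, e0, hne⟩
    have hp : Params.Coded ℓ h ⟨n, m, v, d, k⟩ := ⟨e1.symm, e2.symm, e3.symm, e4.symm, e5.symm⟩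
    refine ⟨_, u, d', y, hp, e6.symm, e7.symm, e8.symm, ?_, ?_⟩
    · rw [e0, codeHistory_append_cons_cons, ht h _ hp, e6, e7, e8]
    · rintro rfl
      exact hne (e7.symm.trans (ht' h _ hp).symm)
  · rintro ⟨p, u, d, y, hp, e6, e7, e8, e0, hne⟩
    refine ⟨⟨_, hp.1.symm⟩, ⟨_, hp.2.1.symm⟩, ⟨_, hp.2.2.1.symm⟩, ⟨_, hp.2.2.2.1.symm⟩,
      ⟨_, hp.2.2.2.2.symm⟩, ⟨_, e6.symm⟩, ⟨_, e7.symm⟩, ⟨_, e8.symm⟩, ?_, ?_⟩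
    · rw [e0, codeHistory_append_cons_cons, ht h _ hp, e6, e7, e8]
    · rw [ht' h p hp, e7]
      exact fun e => hne (codeConfig_injective hℓ e)

/-- Variable 0 does not code a nonempty sequence of configurations that ends with the halted one
and follows the machine. -/
def NotTrace (ℓ : Fin 4 → A) (tag : Instr → ℕ) (T : List Instr) (h : Subst A) : Prop :=
  h 0 ∉ Set.range (codeHistory ℓ) ∨ h 0 = [] ∨
  (∃ u d, h 6 = codeHistory ℓ u ∧ h 7 = codeConfig ℓ d ∧ h 0 = codeHistory ℓ (u ++ [d]) ∧
    d ≠ []) ∨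
  Violates ℓ (fun p => [p.v]) (fun _ => []) h ∨
  ∃ i ∈ T, ∃ V ∈ currentShapes, ∃ D ∈ storedShapes,
    Violates ℓ (before tag i V D) (after tag i V D) h

theorem definable_notTrace [Finite A] (hℓ : Function.Injective ℓ) (tag : Instr → ℕ)
    (T : List Instr) : Definable (NotTrace ℓ tag T) := by
  refine (Definable.mem (isRegular_codeHistory hℓ) 0).not.or (.or ?_ (.or ?_ (.or ?_ ?_)))
  · exact (Definable.eq [.inr 0] []).congr fun h => by rw [Term.eval_var]; rfl
  · refine ((Definable.mem (isRegular_codeHistory hℓ) 6).and <|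
      (Definable.mem (isRegular_codeConfig hℓ) 7).and <|
      (Definable.eq [.inr 0] ([.inr 6] ++ ([.inr 7] ++ [ℓ 3].map .inl))).and
      (Definable.eq [.inr 7] ([].map .inl)).not).congr fun h => ?_
    simp only [Term.eval_append, Term.eval_var, Term.eval_const]
    constructor
    · rintro ⟨⟨u, e6⟩, ⟨d, e7⟩, e0, hne⟩
      refine ⟨u, d, e6.symm, e7.symm, ?_, ?_⟩
      · rw [e0, ← e6, ← e7]
        simp [codeHistory]
      · rintro rfl
        exact hne e7.symm
    · rintro ⟨u, d, e6, e7, e0, hne⟩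
      refine ⟨⟨u, e6.symm⟩, ⟨d, e7.symm⟩, ?_, ?_⟩
      · rw [e0, e6, e7]
        simp [codeHistory]
      · rw [e7]
        exact fun e => hne (codeConfig_injective hℓ (e.trans rfl))
  · exact definable_violates hℓ (.cons .v (.const [])) (.const [])
  · exact .exists_mem _ fun i _ => .exists_mem _ fun V hV => .exists_mem _ fun D hD =>
      definable_violates hℓ (representable_before tag i hV hD) (representable_after tag i hV hD)

theorem Violates.not_trace (hℓ : Function.Injective ℓ) {tag : Instr → ℕ} {T : List Instr}
    {X Y : Params → Config} (hXY : ∀ p, MStep tag T (X p) (Y p)) {h : Subst A} {H : List Config}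
    (h0 : h 0 = codeHistory ℓ H) (hv : Violates ℓ X Y h) : ¬ Trace tag T H := by
  obtain ⟨p, u, d, y, -, -, -, -, e0, hne⟩ := hv
  exact (not_trace_iff H).2 (.inr (.inr ⟨u, X p, d, y, Y p,
    codeHistory_injective hℓ (h0.symm.trans e0), hXY p, hne⟩))

theorem NotTrace.not_trace (hℓ : Function.Injective ℓ) {tag : Instr → ℕ} {T : List Instr}
    {h : Subst A} {H : List Config} (h0 : h 0 = codeHistory ℓ H) (hn : NotTrace ℓ tag T h) :
    ¬ Trace tag T H := by
  rcases hn with hn | hn | ⟨u, d, -, -, e0, hne⟩ | hn | ⟨i, hi, V, -, D, -, hn⟩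
  · exact absurd ⟨H, h0.symm⟩ hn
  · obtain rfl : H = [] := codeHistory_injective hℓ (h0.symm.trans hn)
    exact id
  · exact (not_trace_iff H).2 (.inr (.inl ⟨u, d, hne, codeHistory_injective hℓ (h0.symm.trans e0)⟩))
  · exact hn.not_trace hℓ (fun p => .halt _) h0
  · exact hn.not_trace hℓ (fun p => .exec hi _ _ _) h0

/-- The substitution that maps variable 0 to `w` and the variables 1 to 8 to the codes of the given
objects. -/
def codeSubst (ℓ : Fin 4 → A) (w : List A) (p : Params) (u : List Config) (d : Config)
    (y : List Config) : Subst A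
  | 0 => w
  | 1 => codeNat ℓ p.n
  | 2 => codeNat ℓ p.m
  | 3 => codeList ℓ p.v
  | 4 => codeList ℓ p.d
  | 5 => codeConfig ℓ p.k
  | 6 => codeHistory ℓ u
  | 7 => codeConfig ℓ d
  | 8 => codeHistory ℓ y
  | _ => []

theorem exists_notTrace {tag : Instr → ℕ} {T : List Instr} {H : List Config}
    (hH : ¬ Trace tag T H) : ∃ h : Subst A, h 0 = codeHistory ℓ H ∧ NotTrace ℓ tag T h := by
  let w := codeHistory ℓ H
  let p₀ : Params := ⟨0, 0, [], [], []⟩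
  rcases (not_trace_iff H).1 hH with hH | ⟨u, d, hd, hH⟩ | ⟨u, x, y, l, z, hH, hs, hne⟩
  · exact ⟨codeSubst ℓ w p₀ [] [] [], rfl, .inr (.inl (congrArg (codeHistory ℓ) hH))⟩
  · exact ⟨codeSubst ℓ w p₀ u d [], rfl, .inr (.inr (.inl ⟨u, d, rfl, rfl,
      congrArg (codeHistory ℓ) hH, hd⟩))⟩
  · rcases hs with v | @⟨i, hi, d, v, k⟩
    · exact ⟨codeSubst ℓ w ⟨0, 0, v, [], []⟩ u y l, rfl, .inr <| .inr <| .inr <| .inl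
        ⟨_, u, y, l, ⟨rfl, rfl, rfl, rfl, rfl⟩, rfl, rfl, rfl, congrArg (codeHistory ℓ) hH, hne⟩⟩
    -- A shape of `v` uses only `n` and `v'`; quantifying over the other parameters allows a
    -- combination with the independent choice for `d` below.
    · obtain ⟨V, hV, n, v', hv⟩ : ∃ V ∈ currentShapes, ∃ n v', ∀ m d k, v = V ⟨n, m, v', d, k⟩ := by
        rcases v with _ | ⟨_ | n, v⟩
        · exact ⟨fun _ => [], by simp [currentShapes], 0, [], fun _ _ _ => rfl⟩
        · exact ⟨fun p => 0 :: p.v, by simp [currentShapes], 0, v, fun _ _ _ => rfl⟩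
        · exact ⟨fun p => (p.n + 1) :: p.v, by simp [currentShapes], n, v, fun _ _ _ => rfl⟩
      obtain ⟨D, hD, m, d', hd⟩ : ∃ D ∈ storedShapes, ∃ m d', ∀ n v k, d = D ⟨n, m, v, d', k⟩ := by
        rcases d with _ | ⟨m, d⟩
        · exact ⟨fun _ => [], by simp [storedShapes], 0, [], fun _ _ _ => rfl⟩
        · exact ⟨fun p => p.m :: p.d, by simp [storedShapes], m, d, fun _ _ _ => rfl⟩
      refine ⟨codeSubst ℓ w ⟨n, m, v', d', k⟩ u y l, rfl, .inr <| .inr <| .inr <| .inr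
        ⟨i, hi, V, hV, D, hD, ⟨n, m, v', d', k⟩, u, y, l, ⟨rfl, rfl, rfl, rfl, rfl⟩, rfl, rfl, rfl,
          congrArg (codeHistory ℓ) ?_, ?_⟩⟩
      · rw [hH, before, ← hv, ← hd]
      · rw [after, ← hv, ← hd]
        exact hne

/-- Variable 0 codes a nonempty sequence of configurations that starts with the configuration coded
by variable 7. -/
def StartsWith (ℓ : Fin 4 → A) (h : Subst A) : Prop :=
  ∃ d y, h 7 = codeConfig ℓ d ∧ h 8 = codeHistory ℓ y ∧ h 0 = codeHistory ℓ (d :: y)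

theorem definable_startsWith [Finite A] (hℓ : Function.Injective ℓ) :
    Definable (StartsWith ℓ) := by
  refine ((Definable.mem (isRegular_codeConfig hℓ) 7).and <|
    (Definable.mem (isRegular_codeHistory hℓ) 8).and <|
    (Definable.eq [.inr 0] ([.inr 7] ++ ([ℓ 3].map .inl ++ [.inr 8])))).congr fun h => ?_
  simp only [Term.eval_append, Term.eval_var, Term.eval_const]
  constructor
  · rintro ⟨⟨d, e7⟩, ⟨y, e8⟩, e0⟩
    refine ⟨d, y, e7.symm, e8.symm, ?_⟩
    rw [e0, ← e7, ← e8]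
    simp [codeHistory]
  · rintro ⟨d, y, e7, e8, e0⟩
    refine ⟨⟨d, e7.symm⟩, ⟨y, e8.symm⟩, ?_⟩
    rw [e0, e7, e8]
    simp [codeHistory]

/-- Every word over `S` is the value of variable 0 for some substitution that refutes that it codes a
halting computation from `c` exactly if there is no such computation. -/
theorem forall_exists_iff_forall_not_trace (hℓ : Function.Injective ℓ) {S : Set A}
    (hS : ∀ j, ℓ j ∈ S) (tag : Instr → ℕ) (T : List Instr) (c : Config) :
    (∀ w ∈ starOf S, ∃ h : Subst A, h 0 = w ∧
      (NotTrace ℓ tag T h ∨ StartsWith ℓ h ∧ h 7 ≠ codeConfig ℓ c)) ↔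
    ∀ l, ¬ Trace tag T (c :: l) := by
  constructor
  · intro hall l
    obtain ⟨h, h0, hn | ⟨⟨d, y, e7, -, e0⟩, hne⟩⟩ := hall (codeHistory ℓ (c :: l)) (by
      intro x hx
      rcases mem_codeHistory ℓ hx with rfl | rfl | rfl | rfl <;> exact hS _)
    · exact hn.not_trace hℓ h0
    · have := codeHistory_injective hℓ (h0.symm.trans e0)
      rw [e7, (List.cons.inj this).1] at hne
      exact absurd rfl hne
  · intro hl w _
    by_cases hw : w ∈ Set.range (codeHistory ℓ)
    · obtain ⟨H, rfl⟩ := hw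
      -- A genuine trace is refuted by its first configuration, which differs from `c` by
      -- assumption.
      by_cases hH : Trace tag T H
      · rcases H with _ | ⟨d, y⟩
        · exact hH.elim
        · refine ⟨codeSubst ℓ (codeHistory ℓ (d :: y)) ⟨0, 0, [], [], []⟩ [] d y, rfl,
            .inr ⟨⟨d, y, rfl, rfl, rfl⟩, fun e => ?_⟩⟩
          obtain rfl : d = c := codeConfig_injective hℓ e
          exact hl y hH
      · obtain ⟨h, h0, hn⟩ := exists_notTrace (ℓ := ℓ) hH
        exact ⟨h, h0, .inl hn⟩
    · exact ⟨fun _ => w, rfl, .inl (.inl hw)⟩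

end History

/-! ### Reduction from the halting problem -/

section Reduction

theorem Formula.primrec₂_and [Primcodable A] : Primrec₂ (Formula.and (A := A)) :=
  Primrec.encode_iff.1 <| (Primrec.nat_add.comp (Primrec.nat_mul.comp (Primrec.const 6)
    (Primrec₂.natPair.comp (Primrec.encode.comp Primrec.fst) (Primrec.encode.comp Primrec.snd)))
    (Primrec.const 2)).of_eq fun _ => rfl

theorem Formula.primrec₂_or [Primcodable A] : Primrec₂ (Formula.or (A := A)) :=
  Primrec.encode_iff.1 <| (Primrec.nat_add.comp (Primrec.nat_mul.comp (Primrec.const 6)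
    (Primrec₂.natPair.comp (Primrec.encode.comp Primrec.fst) (Primrec.encode.comp Primrec.snd)))
    (Primrec.const 3)).of_eq fun _ => rfl

theorem Formula.primrec_neg [Primcodable A] : Primrec (Formula.neg (A := A)) :=
  Primrec.encode_iff.1 <| (Primrec.nat_add.comp (Primrec.nat_mul.comp (Primrec.const 6)
    Primrec.encode) (Primrec.const 1)).of_eq fun _ => rfl

theorem Formula.primrec_atom [Primcodable A] : Primrec (Formula.atom (A := A)) :=
  Primrec.encode_iff.1 <| (Primrec.nat_mul.comp (Primrec.const 6) Primrec.encode).of_eq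
    fun _ => rfl

theorem Atom.primrec₂_eq [Primcodable A] : Primrec₂ (Atom.eq (A := A)) :=
  ((Primrec.of_equiv_symm (e := Atom.equivSum (A := A))).comp
    (Primrec.sumInr.comp (Primrec.sumInr.comp Primrec.id))).of_eq fun _ => rfl

theorem primrec_replicate {β : Type*} [Primcodable β] (b : β) :
    Primrec fun n : ℕ => List.replicate n b :=
  (Primrec.list_map Primrec.list_range (Primrec.const b).to₂).of_eq fun n => by simp

/-- There is a code whose halting problem is undecidable. -/
theorem exists_code_not_computablePred :
    ∃ c : Turing.ToPartrec.Code, ¬ ComputablePred fun n : ℕ => (c.eval [n]).Dom := by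
  have hu : Partrec fun n : ℕ => Nat.Partrec.Code.eval (Denumerable.ofNat Nat.Partrec.Code n) 0 :=
    Nat.Partrec.Code.eval_part.comp (Primrec.ofNat Nat.Partrec.Code).to_comp (Computable.const 0)
  obtain ⟨c, hc⟩ := Turing.ToPartrec.Code.exists_code (Nat.Partrec'.part_iff₁.2 hu)
  refine ⟨c, fun hcomp => ComputablePred.halting_problem 0 ?_⟩
  have hdom (n : ℕ) : (c.eval [n]).Dom ↔
      (Nat.Partrec.Code.eval (Denumerable.ofNat Nat.Partrec.Code n) 0).Dom := by
    have h := hc ⟨[n], rfl⟩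
    change c.eval [n] = _ at h
    rw [h]
    rfl
  obtain ⟨_, hd⟩ := hcomp
  refine ⟨Classical.decPred _, (hd.comp Computable.encode).of_eq fun c' => ?_⟩
  exact decide_eq_decide.2 ((hdom _).trans (by rw [Denumerable.ofNat_encode]))

theorem Instr.exists_injOn (T : List Instr) : ∃ tag : Instr → ℕ, Set.InjOn tag {i | i ∈ T} := by
  classical
  exact ⟨fun i => T.idxOf i, fun i hi j _ h => (List.idxOf_inj hi).1 h⟩

theorem not_starProblemDecidable_WEREG [Finite A] [Primcodable A] (S : Set A)
    (hS : 4 ≤ S.ncard) : ¬ StarProblemDecidable (WEREG A) S := by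
  rintro ⟨dec, hdec, hcorrect⟩
  obtain ⟨ℓ, hℓ, hℓS⟩ : ∃ ℓ : Fin 4 → A, Function.Injective ℓ ∧ ∀ j, ℓ j ∈ S := by
    have := Fintype.ofFinite S
    have hcard : Fintype.card (Fin 4) ≤ Fintype.card S := by
      rwa [Fintype.card_fin, ← Nat.card_eq_fintype_card, Nat.card_coe_set_eq]
    obtain ⟨g⟩ := Function.Embedding.nonempty_of_card_le hcard
    exact ⟨fun j => g j, Subtype.val_injective.comp g.injective, fun j => (g j).2⟩
  obtain ⟨c, hc⟩ := exists_code_not_computablePred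
  obtain ⟨T, hcT, hT⟩ := Instr.exists_closed c
  obtain ⟨tag, htag⟩ := Instr.exists_injOn T
  obtain ⟨M, hM⟩ := exists_automaton (isRegular_starOf S)
  obtain ⟨G, hG, hG'⟩ := definable_notTrace hℓ tag T
  obtain ⟨E, hE, hE'⟩ := definable_startsWith hℓ
  let start : ℕ → Config := fun n => [[n], [tag (.run c)]]
  let rest : List A := ℓ 1 :: ℓ 2 :: (codeConfig ℓ [[tag (.run c)]])
  have hstart (n : ℕ) : codeConfig ℓ (start n) = List.replicate n (ℓ 0) ++ rest := by
    simp [codeConfig, codeList, codeNat, start, rest]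
  -- Only the constant in the last equation depends on `n`, so computability of the reduction
  -- concerns a single word.
  let φ : ℕ → Formula A := fun n => .and (.atom (.mem [.inr 0] M)) (.or G (.and E
    (.neg (.atom (.eq [.inr 7] ((List.replicate n (ℓ 0) ++ rest).map .inl))))))
  have hφ : Primrec φ := by
    refine Formula.primrec₂_and.comp (Primrec.const _) (Formula.primrec₂_or.comp (Primrec.const _)
      (Formula.primrec₂_and.comp (Primrec.const _) (Formula.primrec_neg.comp
        (Formula.primrec_atom.comp (Atom.primrec₂_eq.comp (Primrec.const _) ?_)))))
    exact Primrec.list_map (Primrec.list_append.comp (primrec_replicate _) (Primrec.const _))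
      (Primrec.sumInl.comp Primrec.snd).to₂
  have hvalid (n : ℕ) : φ n ∈ WEREG A ∧ 0 ∈ (φ n).vars :=
    ⟨⟨.inr trivial, hG, hE, .inl trivial⟩, .inl (by simp [Formula.vars, Atom.vars, Term.vars])⟩
  have hlang (n : ℕ) : (φ n).lang 0 = starOf S ↔ ¬ (c.eval [n]).Dom := by
    rw [← exists_trace_iff htag hT c hcT [n], not_exists,
      ← forall_exists_iff_forall_not_trace hℓ hℓS]
    have hholds (h : Subst A) : (φ n).Holds h ↔ h 0 ∈ starOf S ∧
        (NotTrace ℓ tag T h ∨ StartsWith ℓ h ∧ h 7 ≠ codeConfig ℓ (start n)) := by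
      refine and_congr ?_ (or_congr (hG' h) (and_congr (hE' h) (not_congr ?_)))
      · change Term.eval h [.inr 0] ∈ (Automaton.toNFA M).accepts ↔ _
        rw [hM, Term.eval_var]
      · change Term.eval h [.inr 7] = Term.eval h _ ↔ _
        rw [Term.eval_var, Term.eval_const, hstart]
    constructor
    · intro e w hw
      rw [← e] at hw
      obtain ⟨h, h0, hh⟩ := hw
      exact ⟨h, h0, ((hholds h).1 hh).2⟩
    · intro hall
      ext w
      constructor
      · rintro ⟨h, rfl, hh⟩
        exact ((hholds h).1 hh).1
      · intro hw
        obtain ⟨h, h0, hh⟩ := hall w hw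
        exact ⟨h, h0, (hholds h).2 ⟨h0 ▸ hw, hh⟩⟩
  refine hc ⟨Classical.decPred _, ((Primrec.not.to_comp.comp
    (hdec.comp (hφ.pair (Primrec.const 0)).to_comp))).of_eq fun n => ?_⟩
  have h := (hcorrect (φ n, 0) (hvalid n)).trans (hlang n)
  by_cases hn : (c.eval [n]).Dom
  · have hf : dec (φ n, 0) = false := Bool.eq_false_iff.2 fun e => h.1 e hn
    simp [hn, hf]
  · simp [hn, h.2 hn]

theorem not_subsetUniversalityDecidable_WEREG [Finite A] [Primcodable A] (hA : 4 < Nat.card A) :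
    ¬ SubsetUniversalityDecidable (WEREG A) := by
  rintro ⟨dec, hdec, hcorrect⟩
  -- Four letters suffice for the codes, and a fifth letter of the alphabet makes `S` a proper
  -- subset.
  obtain ⟨S, -, hS⟩ := Set.exists_subset_card_eq (s := (Set.univ : Set A)) (n := 4)
    (by rw [Set.ncard_univ]; exact hA.le)
  have hl : {a | a ∈ S.toFinite.toFinset.toList} = S := by ext; simp
  refine not_starProblemDecidable_WEREG S hS.ge
    ⟨fun i => dec (i, S.toFinite.toFinset.toList),
      hdec.comp (Computable.id.pair (Computable.const _)), fun i hi => ?_⟩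
  have h := hcorrect (i, S.toFinite.toFinset.toList) ⟨hi.1, hi.2, by simp only [hl]; omega, ?_⟩
  · simpa only [hl] using h
  · simp only [hl]
    refine Set.ssubset_univ_iff.2 fun e => ?_
    rw [e, Set.ncard_univ] at hS
    omega

end Reduction

end StringTheory

theorem mainTheorem8 :
    -- WE+LEN: subset-universality is decidable, and `S*` is never expressible
    (∀ (A : Type u) [Finite A] [Primcodable A],
      StringTheory.SubsetUniversalityDecidable (StringTheory.WELEN A)) ∧
    (∀ (A : Type u) [Finite A] (S : Set A), 1 < S.ncard → S ⊂ Set.univ →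
      ¬ StringTheory.Expressible (StringTheory.WELEN A) (StringTheory.starOf S)) ∧
    -- WE+REG: undecidable for all large enough alphabets, and for every fixed large enough `S`
    (∃ N : ℕ,
      (∀ (A : Type u) [Finite A] [Primcodable A], N < Nat.card A →
        ¬ StringTheory.SubsetUniversalityDecidable (StringTheory.WEREG A)) ∧
      (∀ (A : Type u) [Finite A] [Primcodable A] (S : Set A), N ≤ S.ncard →
        ¬ StringTheory.StarProblemDecidable (StringTheory.WEREG A) S)) := by
  refine ⟨fun A _ _ => StringTheory.subsetUniversalityDecidable_WELEN,
    fun A _ S h1 h2 => StringTheory.not_expressible_starOf S h1 h2, 4,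
    fun A _ _ hA => StringTheory.not_subsetUniversalityDecidable_WEREG hA,
    fun A _ _ S hS => StringTheory.not_starProblemDecidable_WEREG S hS⟩
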